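/- **Setting.** Let $\Omega\subset\mathbb R^2$ be a bounded polygonal domain (open, connected, equal to the interior of its closure), $T>0$, and let $|\cdot|$, $(\cdot,\cdot)$ denote the norm and scalar product of $L^2(\Omega)$ and $L^2(\Omega)^2$. Let $D_c,D_\theta,\lambda,\theta_*,\kappa_{inf}>0$ and $0<\theta_-<\theta_+$. Let $\kappa\in W^{1,\infty}((0,1)\times(0,\infty))$ (continuous representative, extended by continuity to $[0,1]\times(0,\infty)$) satisfy $\kappa\ge\kappa_{inf}$. Let $s,s_c,s_\theta\in L^2(\Omega)$, let $\mathbf f(t)\in L^2(\Omega)^2$ for $t\in[0,T]$ with $t\mapsto|\mathbf f(t)|$ continuous, and let $c_0,\theta_0\in H^1(\Omega)$. Assume that a.e. in $\Omega$ $$0\le c_0\le 1,\quad \theta_-\le\theta_0\le\theta_+,\quad 2s+\lambda\ge s_c\ge 0,\quad 2(\theta_--\theta_*)s+s_\theta\le 0,\quad 2(\theta_+-\theta_*)s+s_\theta\ge 0 .$$ **Mesh.** Let $\mathcal T_h$ be a conforming triangular mesh of $\Omega$ with all angles less than $\pi/2$. For a triangle $K$ let $x_K$ be its circumcenter, $|K|$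 its area, $\mathcal E_K$ its set of edges, and $\mathbf n_{K,\sigma}$ its outward unit normal on $\sigma\in\mathcal E_K$; $h$ is the largest diameter of the circumscribed circles. An edge $\sigma$ has length $|\sigma|$ and midpoint $x_\sigma$. An interior edge is shared by two triangles $K_\sigma,L_\sigma$, and $d_\sigma=|x_{K_\sigma}-x_{L_\sigma}|$; an exterior edge belongs to one triangle $K_\sigma$, and $d_\sigma=|x_{K_\sigma}-x_\sigma|$. The interior edges form $\mathcal E^{int}_h$, and $\tau_\sigma=|\sigma|/d_\sigma$. The mesh is called $\rho$-regular ($\rho>0$) if $d_\sigma\ge\rho|\sigma|$ and $|\sigma|\ge\rho h$ for every edge $\sigma$. **Discrete spaces and operators.** $P_0$: functions constant on each triangle, $q_K=q|_K$. $P_1^{nc}$: functions affine on each triangle and continuous at the midpoints of interior edges. $RT_0$: vector fields affine on each triangle, with normal component constant on each edge of each triangle, continuous across interior edges and zero on exterior edges. $L^2_0$: functions of zero mean. $\Pi_{P_0}$ is the mean value on each triangle (componentwise for vector fields); $\widetilde\Pi_{P_1^{nc}}$ and $\widetilde\Pi_{RT_0}$ are the $L^2$ projections. $\nabla_h q$ is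 the gradient of $q\in P_1^{nc}$ on each triangle. For $\mathbf v\in P_0^2$, $\mathrm{div}_h\mathbf v\in P_1^{nc}$ is given by $$(\mathrm{div}_h\mathbf v)(x_\sigma)=\frac{3|\sigma|}{|K_\sigma|+|L_\sigma|}(\mathbf v_{L_\sigma}-\mathbf v_{K_\sigma})\cdot\mathbf n_{K_\sigma,\sigma}\ \text{ (interior edges)},\qquad (\mathrm{div}_h\mathbf v)(x_\sigma)=-\frac{3|\sigma|}{|K_\sigma|}\mathbf v_{K_\sigma}\cdot\mathbf n_{K_\sigma,\sigma}\ \text{ (exterior edges)}.$$ For $q\in P_0$, $\mathbf v\in RT_0$ and a triangle $K$, writing $L_\sigma$ for the other triangle of an interior edge $\sigma$ of $K$ and $a^+=\max(a,0)$, $a^-=\min(a,0)$, $$\|q\|_h^2=\sum_{\sigma\in\mathcal E_h^{int}}\tau_\sigma(q_{L_\sigma}-q_{K_\sigma})^2,\qquad (\Delta_h q)_K=\frac1{|K|}\sum_{\sigma\in\mathcal E_K\cap\mathcal E_h^{int}}\tau_\sigma(q_{L_\sigma}-q_K),$$ $$\tilde b_h(\mathbf v,q)_K=\frac1{|K|}\sum_{\sigma\in\mathcal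 E_K\cap\mathcal E_h^{int}}|\sigma|\big((\mathbf v\cdot\mathbf n_{K,\sigma})^+q_K+(\mathbf v\cdot\mathbf n_{K,\sigma})^-q_{L_\sigma}\big).$$ **Scheme.** Let $N\ge1$, $k=T/N$, $t_m=mk$, $s_h=\Pi_{P_0}s$, $s^c_h=\Pi_{P_0}s_c$, $s^\theta_h=\Pi_{P_0}s_\theta$, $\mathbf f^m_h=\Pi_{P_0}\mathbf f(t_m)$. Put $c^0_h=\Pi_{P_0}c_0$, $\theta^0_h=\Pi_{P_0}\theta_0$, and let $\mathbf u^0_h\in RT_0$ satisfy $\mathrm{div}\,\mathbf u^0_h=s_h$. For $0\le n\le N-1$ let $c^{n+1}_h,\theta^{n+1}_h\in P_0$, $p^{n+1}_h\in P_1^{nc}\cap L^2_0$, $\mathbf u^{n+1}_h\in RT_0$ satisfy, with $\kappa^{n+1}_h=\kappa(c^{n+1}_h,\theta^{n+1}_h)$, $$\frac{c^{n+1}_h-c^n_h}{k}-D_c\Delta_hc^{n+1}_h=s^c_h-(s_h+\lambda)c^{n+1}_h-\tilde b_h(\mathbf u^n_h,c^{n+1}_h),$$ $$\frac{\theta^{n+1}_h-\theta^n_h}{k}-D_\theta\Delta_h\theta^{n+1}_h=-s^\theta_h-s_h(\theta^{n+1}_h-\theta_*)-\tilde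 b_h(\mathbf u^n_h,\theta^{n+1}_h),$$ $$\mathrm{div}_h(\kappa^{n+1}_h\nabla_hp^{n+1}_h)=\mathrm{div}_h\mathbf f^{n+1}_h-\widetilde\Pi_{P_1^{nc}}s_h,\qquad \mathbf u^{n+1}_h=\widetilde\Pi_{RT_0}(\mathbf f^{n+1}_h-\kappa^{n+1}_h\nabla_hp^{n+1}_h).$$ **Proposition.** For every $\rho>0$ there is a constant $C$, depending only on $\rho$ and on the data $\Omega$, $T$, $D_c$, $D_\theta$, $\lambda$, $\theta_*$, $\theta_\pm$, $\kappa$, $\kappa_{inf}$, $s$, $s_c$, $s_\theta$, $\mathbf f$, $c_0$, $\theta_0$, such that for every $\rho$-regular mesh, every $N\ge1$, every such $\mathbf u^0_h$ and every solution of the scheme, for all $1\le m\le N$, $$k\sum_{n=1}^m\|c^n_h\|_h^2+k\sum_{n=1}^m\|\theta^n_h\|_h^2\le C\qquad\text{and}\qquad |\mathbf u^m_h|+|\nabla_hp^m_h|\le C .$$ -/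

import Mathlib

open MeasureTheory Set
open scoped ENNReal ContDiff

noncomputable section

namespace DarcyScheme

/-- The Euclidean plane. -/
abbrev Pt : Type := EuclideanSpace ℝ (Fin 2)

/-! ### Sobolev spaces on plane open sets -/

/-- `g` is the weak gradient of `u` in the open set `U`. -/
def HasWeakGradient (U : Set Pt) (u : Pt → ℝ) (g : Pt → Pt) : Prop :=
  ∀ φ : Pt → ℝ, ContDiff ℝ ∞ φ → HasCompactSupport φ → tsupport φ ⊆ U →
    ∀ v : Pt, ∫ x in U, u x * fderiv ℝ φ x v = - ∫ x in U, inner ℝ (g x) v * φ x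

/-- The Sobolev space `W^{1,q}(U)`. -/
def MemW1 (U : Set Pt) (q : ℝ≥0∞) (u : Pt → ℝ) : Prop :=
  MemLp u q (volume.restrict U) ∧
    ∃ g : Pt → Pt, MemLp g q (volume.restrict U) ∧ HasWeakGradient U u g

/-! ### Data of the problem -/

/-- A bounded polygonal domain (not lying on both sides of any part of its boundary). -/
structure IsPolygonalDomain (Ω : Set Pt) : Prop where
  isOpen : IsOpen Ω
  isConnected : IsConnected Ω
  isBounded : Bornology.IsBounded Ω
  regular : interior (closure Ω) = Ω
  polygonal : ∃ S : Finset (Pt × Pt), frontier Ω = ⋃ e ∈ S, segment ℝ e.1 e.2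

/-- The data: domain, final time, diffusion coefficients, decay rate, reference temperature,
temperature bounds, mobility `κ(c, θ)` and its lower bound, sources, body force, initial data. -/
structure Data where
  Ω : Set Pt
  T : ℝ
  Dc : ℝ
  Dθ : ℝ
  lam : ℝ
  θref : ℝ
  θlo : ℝ
  θhi : ℝ
  κ : ℝ → ℝ → ℝ
  κinf : ℝ
  s : Pt → ℝ
  sc : Pt → ℝ
  sθ : Pt → ℝ
  f : ℝ → Pt → Pt
  c₀ : Pt → ℝ
  θ₀ : Pt → ℝ

/-- The standing assumptions on the data. -/
structure Data.Admissible (D : Data) : Prop where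
  domain : IsPolygonalDomain D.Ω
  T_pos : 0 < D.T
  Dc_pos : 0 < D.Dc
  Dθ_pos : 0 < D.Dθ
  lam_pos : 0 < D.lam
  θref_pos : 0 < D.θref
  θlo_pos : 0 < D.θlo
  θlo_lt_θhi : D.θlo < D.θhi
  /-- `κ ∈ W^{1,∞}((0,1) × (0,∞))` ... -/
  κ_mem : MemW1 {z : Pt | 0 < z 0 ∧ z 0 < 1 ∧ 0 < z 1} ∞ (fun z => D.κ (z 0) (z 1))
  /-- ... and `κ` denotes the continuous representative, extended by continuity to the values
  `c = 0` and `c = 1`, since `κ` gets evaluated pointwise. -/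
  κ_cont : ContinuousOn (Function.uncurry D.κ) (Icc 0 1 ×ˢ Ioi 0)
  κinf_pos : 0 < D.κinf
  κ_ge : ∀ a ∈ Icc (0 : ℝ) 1, ∀ b ∈ Ioi (0 : ℝ), D.κinf ≤ D.κ a b
  s_mem : MemLp D.s 2 (volume.restrict D.Ω)
  sc_mem : MemLp D.sc 2 (volume.restrict D.Ω)
  sθ_mem : MemLp D.sθ 2 (volume.restrict D.Ω)
  /-- `f ∈ C(0,T;L²)`, that is, `t ↦ ‖f(t)‖` is continuous. -/
  f_mem : ∀ t ∈ Icc 0 D.T, MemLp (D.f t) 2 (volume.restrict D.Ω)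
  f_cont : ContinuousOn (fun t => (eLpNorm (D.f t) 2 (volume.restrict D.Ω)).toReal) (Icc 0 D.T)
  c₀_mem : MemW1 D.Ω 2 D.c₀
  θ₀_mem : MemW1 D.Ω 2 D.θ₀
  c₀_bounds : ∀ᵐ x ∂(volume.restrict D.Ω), 0 ≤ D.c₀ x ∧ D.c₀ x ≤ 1
  θ₀_bounds : ∀ᵐ x ∂(volume.restrict D.Ω), D.θlo ≤ D.θ₀ x ∧ D.θ₀ x ≤ D.θhi
  sc_bounds : ∀ᵐ x ∂(volume.restrict D.Ω), 0 ≤ D.sc x ∧ D.sc x ≤ 2 * D.s x + D.lam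
  sθ_lo : ∀ᵐ x ∂(volume.restrict D.Ω), 2 * (D.θlo - D.θref) * D.s x + D.sθ x ≤ 0
  sθ_hi : ∀ᵐ x ∂(volume.restrict D.Ω), 0 ≤ 2 * (D.θhi - D.θref) * D.s x + D.sθ x

/-! ### Meshes -/

/-- A conforming triangular mesh of `Ω` all of whose angles are acute. -/
structure Mesh (Ω : Set Pt) where
  /-- number of triangles -/
  n : ℕ
  tri : Fin n → Affine.Triangle ℝ Pt
  distinct : Function.Injective fun K => range (tri K).points
  covers : ⋃ K, convexHull ℝ (range (tri K).points) = closure Ω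
  /-- two triangles meet exactly in the face spanned by their common vertices -/
  conforming : ∀ K L, K ≠ L →
    convexHull ℝ (range (tri K).points) ∩ convexHull ℝ (range (tri L).points) =
      convexHull ℝ (range (tri K).points ∩ range (tri L).points)
  acute : ∀ K, (tri K).AcuteAngled

namespace Mesh

variable {Ω : Set Pt} (M : Mesh Ω)

/-- The closed triangle `K`. -/
def cell (K : Fin M.n) : Set Pt := convexHull ℝ (range (M.tri K).points)

/-- `|K|` -/
def area (K : Fin M.n) : ℝ := volume.real (M.cell K)

/-- `x_K` -/
def center (K : Fin M.n) : Pt := (M.tri K).circumcenter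

/-- `h`, the largest diameter of the circumscribed circles. -/
def size : ℝ := ⨆ K, 2 * (M.tri K).circumradius

/-- The edge of `K` opposite to its `i`-th vertex, as the pair of its end points. Every edge of
the mesh is of this form, for one triangle (exterior edge) or for two (interior edge). -/
def edge (K : Fin M.n) (i : Fin 3) : Sym2 Pt :=
  s((M.tri K).points (i + 1), (M.tri K).points (i + 2))

/-- The edge of `K` opposite to its `i`-th vertex, as a set of points. -/
def edgeSet (K : Fin M.n) (i : Fin 3) : Set Pt :=
  segment ℝ ((M.tri K).points (i + 1)) ((M.tri K).points (i + 2))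

/-- `|σ|` -/
def len (K : Fin M.n) (i : Fin 3) : ℝ :=
  dist ((M.tri K).points (i + 1)) ((M.tri K).points (i + 2))

/-- `x_σ` -/
def mid (K : Fin M.n) (i : Fin 3) : Pt :=
  midpoint ℝ ((M.tri K).points (i + 1)) ((M.tri K).points (i + 2))

/-- `n_{K,σ}`: the unit vector pointing from the `i`-th vertex of `K` to the foot of the altitude
on the opposite edge `σ`. -/
def normal (K : Fin M.n) (i : Fin 3) : Pt :=
  ((M.tri K).height i)⁻¹ • ((M.tri K).altitudeFoot i - (M.tri K).points i)

open scoped Classical in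
/-- The interior edges, each listed once, with its two triangles: the element `((K, i), (L, j))`
stands for the edge `σ` that is opposite to the `i`-th vertex of `K = K_σ` and to the `j`-th vertex
of `L = L_σ`. The triangle with the smaller number is taken for `K_σ`. -/
def intEdges : Finset ((Fin M.n × Fin 3) × (Fin M.n × Fin 3)) :=
  Finset.univ.filter fun e => e.1.1 < e.2.1 ∧ M.edge e.1.1 e.1.2 = M.edge e.2.1 e.2.2

/-- The `i`-th edge of `K` is an exterior edge: it belongs to no other triangle. -/
def IsExt (K : Fin M.n) (i : Fin 3) : Prop :=
  ∀ L j, M.edge L j = M.edge K i → L = K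

open scoped Classical in
/-- The interior edges of the triangle `K`: the element `(i, L)` stands for the edge opposite
to the `i`-th vertex of `K`, whose other triangle is `L`. -/
def nbrs (K : Fin M.n) : Finset (Fin 3 × Fin M.n) :=
  Finset.univ.filter fun e => e.2 ≠ K ∧ ∃ j, M.edge e.2 j = M.edge K e.1

/-- `τ_σ = |σ| / d_σ` for the interior edge `σ` of `K` that is opposite to its `i`-th vertex and
whose other triangle is `L`. -/
def tau (K : Fin M.n) (i : Fin 3) (L : Fin M.n) : ℝ :=
  M.len K i / dist (M.center K) (M.center L)

/-- The mesh regularity `d_σ ≥ C |σ|` and `|σ| ≥ C h` for every edge `σ`. -/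
structure Regular (C : ℝ) : Prop where
  int_dist : ∀ e ∈ M.intEdges,
    C * M.len e.1.1 e.1.2 ≤ dist (M.center e.1.1) (M.center e.2.1)
  ext_dist : ∀ K i, M.IsExt K i → C * M.len K i ≤ dist (M.center K) (M.mid K i)
  len_ge : ∀ K i, C * M.size ≤ M.len K i

/-! ### Discrete spaces

A function on `Ω` that is defined piecewise on the mesh is given by the family of its restrictions
to the triangles. -/

/-- The space `P₀`: one value per triangle. -/
abbrev P0 : Type := Fin M.n → ℝ

/-- The space `P₀ × P₀`. -/
abbrev P0v : Type := Fin M.n → Pt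

/-- The space `P₁^d`: one affine function per triangle. -/
abbrev P1d : Type := Fin M.n → (Pt →ᵃ[ℝ] ℝ)

/-- The space `P₁^d × P₁^d`. -/
abbrev P1dv : Type := Fin M.n → (Pt →ᵃ[ℝ] Pt)

/-- The `L²` scalar product of two piecewise defined functions. -/
def l2 {F : Type} [NormedAddCommGroup F] [InnerProductSpace ℝ F] (u v : Fin M.n → Pt → F) : ℝ :=
  ∑ K, ∫ x in M.cell K, inner ℝ (u K x) (v K x)

/-- The `L²` norm of a piecewise defined function. -/
def l2norm {F : Type} [NormedAddCommGroup F] [InnerProductSpace ℝ F] (u : Fin M.n → Pt → F) : ℝ :=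
  Real.sqrt (M.l2 u u)

/-- A piecewise constant function, as a piecewise defined function. -/
def pc {F : Type} (q : Fin M.n → F) : Fin M.n → Pt → F := fun K _ => q K

/-- A piecewise affine function, as a piecewise defined function. -/
def pa {F : Type} [AddCommGroup F] [Module ℝ F] (q : Fin M.n → (Pt →ᵃ[ℝ] F)) :
    Fin M.n → Pt → F := fun K x => q K x

/-- The nonconforming space `P₁^{nc}`: continuity at the middle of the interior edges. -/
def IsP1nc (q : M.P1d) : Prop :=
  ∀ e ∈ M.intEdges, q e.1.1 (M.mid e.1.1 e.1.2) = q e.2.1 (M.mid e.1.1 e.1.2)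

/-- Zero mean value, that is, membership in `L²₀`. -/
def IsMeanZero (q : M.P1d) : Prop := ∑ K, ∫ x in M.cell K, q K x = 0

/-- The space `RT₀^d`: the normal component is constant on every edge of every triangle. -/
def IsRT0d (v : M.P1dv) : Prop :=
  ∀ K i, ∀ x ∈ M.edgeSet K i, ∀ y ∈ M.edgeSet K i,
    inner ℝ (v K x) (M.normal K i) = inner ℝ (v K y) (M.normal K i)

/-- The Raviart-Thomas space `RT₀`: the normal component is moreover continuous across interior
edges and zero on exterior edges. -/
structure IsRT0 (v : M.P1dv) : Prop where
  rt0d : M.IsRT0d v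
  int_normal : ∀ e ∈ M.intEdges, ∀ x ∈ M.edgeSet e.1.1 e.1.2,
    inner ℝ (v e.1.1 x) (M.normal e.1.1 e.1.2) = inner ℝ (v e.2.1 x) (M.normal e.1.1 e.1.2)
  ext_normal : ∀ K i, M.IsExt K i → ∀ x ∈ M.edgeSet K i, inner ℝ (v K x) (M.normal K i) = 0

/-- `(v · n_{K,σ})_σ`, for `v ∈ RT₀`. -/
def flux (v : M.P1dv) (K : Fin M.n) (i : Fin 3) : ℝ := inner ℝ (v K (M.mid K i)) (M.normal K i)

/-- `div v` on the triangle `K`, for `v` affine on each triangle. -/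
def divRT (v : M.P1dv) : M.P0 := fun K => LinearMap.trace ℝ Pt (v K).linear

/-- The discrete `H¹` norm `‖q‖_h` of `q ∈ P₀`. -/
def normh (q : M.P0) : ℝ :=
  Real.sqrt (∑ e ∈ M.intEdges, M.tau e.1.1 e.1.2 e.2.1 * (q e.2.1 - q e.1.1) ^ 2)

/-! ### Projections and discrete operators -/

/-- The projection `Π_{P₀}` (also `Π_{P₀ × P₀}`): mean values over the triangles. -/
def projP0 {F : Type} [NormedAddCommGroup F] [NormedSpace ℝ F] (g : Pt → F) : Fin M.n → F :=
  fun K => ⨍ x in M.cell K, g x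

/-- `r` is the `L²` projection on `P₁^{nc}` of the piecewise constant function `g`. -/
def IsProjP1nc (g : M.P0) (r : M.P1d) : Prop :=
  M.IsP1nc r ∧ ∀ ψ : M.P1d, M.IsP1nc ψ → M.l2 (M.pa r) (M.pa ψ) = M.l2 (M.pc g) (M.pa ψ)

/-- `w` is the `L²` projection on `RT₀` of the piecewise constant field `g`. -/
def IsProjRT0 (g : M.P0v) (w : M.P1dv) : Prop :=
  M.IsRT0 w ∧ ∀ ψ : M.P1dv, M.IsRT0 ψ → M.l2 (M.pa w) (M.pa ψ) = M.l2 (M.pc g) (M.pa ψ)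

/-- The discrete gradient `∇_h q`: the gradient of `q` on each triangle. -/
def gradh (q : M.P1d) : M.P0v := fun K =>
  (InnerProductSpace.toDual ℝ Pt).symm (LinearMap.toContinuousLinearMap (q K).linear)

/-- `d = div_h v`, the function `d ∈ P₁^{nc}` with the prescribed values at the middles of the
edges. -/
structure IsDivh (v : M.P0v) (d : M.P1d) : Prop where
  mem : M.IsP1nc d
  int_val : ∀ e ∈ M.intEdges, d e.1.1 (M.mid e.1.1 e.1.2) =
    3 * M.len e.1.1 e.1.2 / (M.area e.1.1 + M.area e.2.1) *
      inner ℝ (v e.2.1 - v e.1.1) (M.normal e.1.1 e.1.2)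
  ext_val : ∀ K i, M.IsExt K i → d K (M.mid K i) =
    -(3 * M.len K i / M.area K) * inner ℝ (v K) (M.normal K i)

/-- The discrete laplacian `Δ_h`. -/
def laph (q : M.P0) : M.P0 := fun K =>
  1 / M.area K * ∑ e ∈ M.nbrs K, M.tau K e.1 e.2 * (q e.2 - q K)

/-- The upwind convection operator `b̃_h(v, q)`. -/
def convh (v : M.P1dv) (q : M.P0) : M.P0 := fun K =>
  1 / M.area K * ∑ e ∈ M.nbrs K,
    M.len K e.1 * (max (M.flux v K e.1) 0 * q K + min (M.flux v K e.1) 0 * q e.2)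

end Mesh

/-! ### The scheme -/

/-- `(c, θ, p, u)` solves the scheme on the mesh `M` with `N` time steps of length `k = T / N`.
Only the values `c m, θ m, u m` for `0 ≤ m ≤ N` and `p m` for `1 ≤ m ≤ N` matter. The initial
velocity is any element of `RT₀` that satisfies the discrete divergence constraint. -/
structure IsSolution (D : Data) (M : Mesh D.Ω) (N : ℕ)
    (c θ : ℕ → M.P0) (p : ℕ → M.P1d) (u : ℕ → M.P1dv) : Prop where
  c_init : c 0 = M.projP0 D.c₀
  θ_init : θ 0 = M.projP0 D.θ₀
  u_init_mem : M.IsRT0 (u 0)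
  u_init_div : M.divRT (u 0) = M.projP0 D.s
  p_mem : ∀ n < N, M.IsP1nc (p (n + 1)) ∧ M.IsMeanZero (p (n + 1))
  eq_c : ∀ n < N, ∀ K,
    (c (n + 1) K - c n K) / (D.T / N) - D.Dc * M.laph (c (n + 1)) K =
      M.projP0 D.sc K - (M.projP0 D.s K + D.lam) * c (n + 1) K - M.convh (u n) (c (n + 1)) K
  eq_θ : ∀ n < N, ∀ K,
    (θ (n + 1) K - θ n K) / (D.T / N) - D.Dθ * M.laph (θ (n + 1)) K =
      - M.projP0 D.sθ K - M.projP0 D.s K * (θ (n + 1) K - D.θref)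
        - M.convh (u n) (θ (n + 1)) K
  /-- `div_h (κ ∇_h p) = div_h f - Π̃ s` -/
  eq_p : ∀ n < N, ∃ a b r : M.P1d,
    M.IsDivh (fun K => D.κ (c (n + 1) K) (θ (n + 1) K) • M.gradh (p (n + 1)) K) a ∧
    M.IsDivh (M.projP0 (D.f ((n + 1 : ℕ) * (D.T / N)))) b ∧
    M.IsProjP1nc (M.projP0 D.s) r ∧
    a = b - r
  /-- `u = Π̃ (f - κ ∇_h p)` -/
  eq_u : ∀ n < N,
    M.IsProjRT0
      (fun K => M.projP0 (D.f ((n + 1 : ℕ) * (D.T / N))) K -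
        D.κ (c (n + 1) K) (θ (n + 1) K) • M.gradh (p (n + 1)) K)
      (u (n + 1))

end DarcyScheme

end

/-!
The bounds on the heat source, `2 (θlo - θref) s + sθ ≤ 0 ≤ 2 (θhi - θref) s + sθ`, force `s ≥ 0`
because `θlo < θhi`. On the other hand `s_h = div u⁰` for a field `u⁰` in `RT₀`, whose normal
component vanishes on the boundary, so that `s` has zero mean over `Ω`. Hence, as soon as a mesh
carries a solution, `s = 0` and then `sθ = 0` almost everywhere, and the bounds on `sc` become
`0 ≤ sc ≤ lam` (`Data.Admissible.sources_ae_eq_zero`): the proposition concerns incompressible flow.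

The pressure equation then says that the piecewise constant field `f_h - κ ∇_h p` has a continuous
normal component that vanishes on the boundary. It belongs to `RT₀`, equals its projection `u`, is
divergence free, and is orthogonal to `∇_h p` by the divergence theorem on each triangle
(`IsSolution.isRT0_flux`, `Mesh.IsRT0.sum_area_mul_inner_gradh`).

Since each `u n` is divergence free, the upwind operator can be written in nonconservative form
(`Mesh.IsRT0.area_mul_convh`). This gives the discrete maximum principle, hence `0 ≤ c ≤ 1` and
`θlo ≤ θ ≤ θhi`, and the nonnegativity of the convection term tested with the unknown itself. The
energy estimates for `c` and `θ` (`Mesh.IsRT0.energy_step`), summed over the time steps, bound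
the discrete `H¹` norms. The bounds on `c` and `θ` keep the mobility between `κinf` and its maximum
on a compact rectangle, so orthogonality bounds `∇_h p` and then `u` by `f`.

The geometric ingredients are an expression of the normals by the vertices
(`Mesh.len_mul_inner_normal`), the fact that triangles with a common edge lie on different sides of
it (`Mesh.cross_mul_cross_neg`), and the resulting rearrangement of sums over edges. The constant
obtained does not depend on `ρ`.
-/

noncomputable section

namespace DarcyScheme

/-! ### Plane geometry of a triangle -/

/-- The signed area of the parallelogram spanned by two plane vectors. -/
def cross (x y : Pt) : ℝ := x 0 * y 1 - x 1 * y 0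

lemma inner_pt (x y : Pt) : inner ℝ x y = x 0 * y 0 + x 1 * y 1 := by
  simp [PiLp.inner_apply, Fin.sum_univ_two, mul_comm]

/-- Twice the signed area of the triangle with the given vertices. -/
def triDet (t : Affine.Triangle ℝ Pt) : ℝ :=
  cross (t.points 1 - t.points 0) (t.points 2 - t.points 0)

lemma triDet_eq_cross (t : Affine.Triangle ℝ Pt) (i : Fin 3) :
    triDet t = cross (t.points (i + 1) - t.points i) (t.points (i + 2) - t.points i) := by
  fin_cases i <;> simp [triDet, cross] <;> ring

/-- The vertices are affinely independent. -/
lemma triDet_ne_zero (t : Affine.Triangle ℝ Pt) : triDet t ≠ 0 := by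
  intro h
  have hi := (affineIndependent_iff_linearIndependent_vsub ℝ t.points 0).1 t.independent
  have h1 : t.points 2 - t.points 0 ≠ 0 := by
    rw [sub_ne_zero]; exact fun h => absurd (t.independent.injective h) (by decide)
  rw [Fintype.linearIndependent_iff] at hi
  set a := t.points 1 - t.points 0 with ha
  set b := t.points 2 - t.points 0 with hb
  have hh : a 0 * b 1 - a 1 * b 0 = 0 := h
  -- the linear relation given by either row of the cofactor matrix
  have key : ∀ k : Fin 2, b k = 0 ∧ a k = 0 := by
    intro k
    have := hi (fun j => if j.1 = 1 then b k else - a k) (by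
      have e : ∀ F : {x : Fin 3 // x ≠ 0} → Pt,
          ∑ j, F j = F ⟨1, by decide⟩ + F ⟨2, by decide⟩ := by
        intro F
        have : (Finset.univ : Finset {x : Fin 3 // x ≠ 0}) =
            {⟨1, by decide⟩, ⟨2, by decide⟩} := by decide
        rw [this, Finset.sum_pair (by decide)]
      rw [e]
      have e1 : t.points 1 -ᵥ t.points 0 = a := rfl
      have e2 : t.points 2 -ᵥ t.points 0 = b := rfl
      simp only [e1, e2]
      ext l
      fin_cases k <;> fin_cases l <;> simp <;> linarith)
    have t1 := this ⟨1, by decide⟩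
    have t2 := this ⟨2, by decide⟩
    simp at t1 t2
    exact ⟨t1, t2⟩
  apply h1
  ext k
  exact (key k).1

/-- In terms of the vertices, the outward unit normal scaled by the length of the edge is the edge
vector turned by a right angle, up to the orientation of the triangle. -/
lemma Mesh.len_mul_inner_normal {Ω : Set Pt} (M : Mesh Ω) (K : Fin M.n) (i : Fin 3) (v : Pt) :
    M.len K i * inner ℝ v (M.normal K i) = SignType.sign (triDet (M.tri K)) *
      cross v ((M.tri K).points (i + 2) - (M.tri K).points (i + 1)) := by
  set t := M.tri K
  set F := t.altitudeFoot i with hF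
  set d := F - t.points i with hd
  set e := t.points (i + 2) - t.points (i + 1) with he
  have h1 : inner ℝ (t.points (i + 1) - F) (t.points i - F) = 0 :=
    t.inner_vsub_altitudeFoot_vsub_altitudeFoot_eq_zero (by fin_cases i <;> decide)
  have h2 : inner ℝ (t.points (i + 2) - F) (t.points i - F) = 0 :=
    t.inner_vsub_altitudeFoot_vsub_altitudeFoot_eq_zero (by fin_cases i <;> decide)
  rw [inner_pt] at h1 h2
  simp only [PiLp.sub_apply] at h1 h2
  have hpos : 0 < t.height i := t.height_pos i
  have hh : t.height i = ‖d‖ := by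
    rw [Affine.Simplex.height, dist_eq_norm, norm_sub_rev]
  have hlen : M.len K i = ‖e‖ := by
    rw [Mesh.len, dist_eq_norm, norm_sub_rev]
  have hdd : ‖d‖ ^ 2 = d 0 * d 0 + d 1 * d 1 := by rw [← inner_pt, real_inner_self_eq_norm_sq]
  have hee : ‖e‖ ^ 2 = e 0 * e 0 + e 1 * e 1 := by rw [← inner_pt, real_inner_self_eq_norm_sq]
  have d0 : d 0 = F 0 - t.points i 0 := rfl
  have d1 : d 1 = F 1 - t.points i 1 := rfl
  have e0 : e 0 = t.points (i + 2) 0 - t.points (i + 1) 0 := rfl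
  have e1 : e 1 = t.points (i + 2) 1 - t.points (i + 1) 1 := rfl
  have horth : d 0 * e 0 + d 1 * e 1 = 0 := by rw [d0, d1, e0, e1]; linarith
  have hdpos : 0 < ‖d‖ := hh ▸ hpos
  -- the foot lies on the edge, so `d` and the edge span the same area as the triangle
  have hdet : triDet t = cross d e := by
    rw [triDet_eq_cross t i]
    have hne : d 0 * d 0 + d 1 * d 1 ≠ 0 := by rw [← hdd]; positivity
    have : (d 0 * d 0 + d 1 * d 1) *
        ((t.points (i + 1) 0 - F 0) * e 1 - (t.points (i + 1) 1 - F 1) * e 0) = 0 := by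
      have h1' : (t.points (i + 1) 0 - F 0) * d 0 + (t.points (i + 1) 1 - F 1) * d 1 = 0 := by
        rw [d0, d1]; linarith
      linear_combination (d 0 * e 1 - d 1 * e 0) * h1' -
        (d 0 * (t.points (i + 1) 1 - F 1) - d 1 * (t.points (i + 1) 0 - F 0)) * horth
    have := (mul_eq_zero.1 this).resolve_left hne
    rw [e0, e1] at this
    simp only [cross, PiLp.sub_apply, d0, d1, e0, e1]
    linarith
  have habs : |triDet t| = ‖d‖ * ‖e‖ := by
    rw [← abs_of_nonneg (mul_nonneg (norm_nonneg d) (norm_nonneg e)), ← sq_eq_sq_iff_abs_eq_abs,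
      mul_pow, hdd, hee, hdet, cross]
    linear_combination (-(d 0 * e 0 + d 1 * e 1)) * horth
  have hn : M.normal K i = (‖d‖)⁻¹ • d := by rw [← hh]; rfl
  rw [hn, inner_smul_right, hlen]
  have hcross : cross v e * ‖d‖ ^ 2 = inner ℝ v d * triDet t := by
    rw [hdet, hdd, inner_pt, cross, cross]
    linear_combination (d 1 * v 0 - d 0 * v 1) * horth
  have hs : (SignType.sign (triDet t) : ℝ) * triDet t = ‖d‖ * ‖e‖ := by
    rw [sign_mul_self, habs]
  have : ‖d‖ ^ 2 * (‖e‖ * (‖d‖⁻¹ * inner ℝ v d)) =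
      ‖d‖ ^ 2 * (SignType.sign (triDet t) * cross v e) := by
    have : ‖d‖ ^ 2 * (‖e‖ * (‖d‖⁻¹ * inner ℝ v d)) = inner ℝ v d * (‖d‖ * ‖e‖) := by
      field_simp
    rw [this, ← hs]
    linear_combination (-(SignType.sign (triDet t) : ℝ)) * hcross
  exact mul_left_cancel₀ (by positivity) this

lemma midpoint_apply_pt (x y : Pt) (k : Fin 2) : midpoint ℝ x y k = (x k + y k) / 2 := by
  rw [midpoint_eq_smul_add]; simp; ring

lemma linear_apply_pt {F : Type*} [AddCommGroup F] [Module ℝ F] (f : Pt →ₗ[ℝ] F) (x : Pt) :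
    f x = x 0 • f (EuclideanSpace.single 0 1) + x 1 • f (EuclideanSpace.single 1 1) := by
  rw [← map_smul, ← map_smul, ← map_add]
  congr 1
  ext k; fin_cases k <;> simp

/-- The divergence theorem for a piecewise affine vector field on one triangle. -/
lemma Mesh.sum_len_flux {Ω : Set Pt} (M : Mesh Ω) (v : M.P1dv) (K : Fin M.n) :
    ∑ i, M.len K i * M.flux v K i = |triDet (M.tri K)| / 2 * M.divRT v K := by
  simp only [Mesh.flux, M.len_mul_inner_normal]
  rw [← Finset.mul_sum, ← sign_mul_self (triDet (M.tri K)), mul_div_assoc, mul_assoc]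
  congr 1
  set t := M.tri K
  rw [Mesh.divRT, LinearMap.trace_eq_sum_inner _ (EuclideanSpace.basisFun (Fin 2) ℝ)]
  have hv : ∀ x : Pt, v K x = (v K).linear (x - t.points 0) + v K (t.points 0) := by
    intro x
    have := (v K).map_vadd (t.points 0) (x - t.points 0)
    simpa using this
  set A := (v K).linear
  simp only [Fin.sum_univ_three, Fin.sum_univ_two, Mesh.mid, EuclideanSpace.basisFun_apply,
    inner_pt, triDet, cross]
  rw [hv (midpoint ℝ _ _), hv (midpoint ℝ _ _), hv (midpoint ℝ _ _)]
  rw [linear_apply_pt A (midpoint ℝ _ _ - _), linear_apply_pt A (midpoint ℝ _ _ - _),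
    linear_apply_pt A (midpoint ℝ _ _ - _)]
  simp [midpoint_apply_pt]
  ring

/-- The divergence theorem for the product of a constant field and an affine function on one
triangle. -/
lemma Mesh.sum_len_inner_normal_mul {Ω : Set Pt} (M : Mesh Ω) (v : Pt) (q : M.P1d)
    (K : Fin M.n) :
    ∑ i, M.len K i * inner ℝ v (M.normal K i) * q K (M.mid K i) =
      |triDet (M.tri K)| / 2 * inner ℝ (M.gradh q K) v := by
  simp only [M.len_mul_inner_normal, mul_assoc]
  rw [← Finset.mul_sum, ← sign_mul_self (triDet (M.tri K)), mul_div_assoc, mul_assoc]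
  congr 1
  set t := M.tri K
  rw [Mesh.gradh, InnerProductSpace.toDual_symm_apply]
  have hv : ∀ x : Pt, q K x = (q K).linear (x - t.points 0) + q K (t.points 0) := by
    intro x
    have := (q K).map_vadd (t.points 0) (x - t.points 0)
    simpa using this
  simp only [LinearMap.coe_toContinuousLinearMap']
  set A := (q K).linear
  simp only [Fin.sum_univ_three, Mesh.mid, triDet, cross]
  rw [hv (midpoint ℝ _ _), hv (midpoint ℝ _ _), hv (midpoint ℝ _ _)]
  rw [linear_apply_pt A (midpoint ℝ _ _ - _), linear_apply_pt A (midpoint ℝ _ _ - _),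
    linear_apply_pt A (midpoint ℝ _ _ - _), linear_apply_pt A v]
  simp [midpoint_apply_pt]
  ring

lemma Mesh.len_pos {Ω : Set Pt} (M : Mesh Ω) (K : Fin M.n) (i : Fin 3) : 0 < M.len K i := by
  refine dist_pos.2 fun h => ?_
  have := (M.tri K).independent.injective h
  revert this; fin_cases i <;> decide

/-! ### Adjacent triangles -/

lemma combo_mem_convexHull {R A B : Pt} {a b c : ℝ} (ha : 0 ≤ a) (hb : 0 ≤ b) (hc : 0 ≤ c)
    (h : a + b + c = 1) : a • R + b • A + c • B ∈ convexHull ℝ ({R, A, B} : Set Pt) := by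
  have := (convex_convexHull ℝ ({R, A, B} : Set Pt)).sum_mem (t := Finset.univ)
    (w := ![a, b, c]) (z := ![R, A, B])
    (by intro i _; fin_cases i <;> assumption) (by simp [Fin.sum_univ_three, h])
    (by intro i _; fin_cases i <;> exact subset_convexHull ℝ _ (by simp))
  simpa [Fin.sum_univ_three] using this

/-- Two triangles on the same side of a common edge `AB` share a point off the line `AB`. -/
lemma exists_mem_convexHull_of_cross_mul_pos {A B P Q : Pt}
    (h : 0 < cross (A - P) (B - P) * cross (A - Q) (B - Q)) :
    ∃ x, x ∈ convexHull ℝ {P, A, B} ∧ x ∈ convexHull ℝ {Q, A, B} ∧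
      cross (A - x) (B - x) ≠ 0 := by
  set dP := cross (A - P) (B - P) with hdP
  set dQ := cross (A - Q) (B - Q) with hdQ
  have hQ0 : dQ ≠ 0 := by rintro h0; simp [h0] at h
  have hP0 : dP ≠ 0 := by rintro h0; simp [h0] at h
  -- barycentric coordinates of `P` in the triangle `QAB`
  set α := dP / dQ with hα
  set β := cross (B - P) (Q - P) / dQ with hβ
  set γ := cross (Q - P) (A - P) / dQ with hγ
  have hα0 : 0 < α := by
    have : α = dP * dQ / dQ ^ 2 := by rw [hα]; field_simp
    rw [this]; positivity
  have hsum : α + β + γ = 1 := by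
    rw [hα, hβ, hγ, ← add_div, ← add_div, div_eq_one_iff_eq hQ0, hdP, hdQ]
    simp only [cross, PiLp.sub_apply]; ring
  have hP : P = α • Q + β • A + γ • B := by
    have : dQ • P = dQ • (α • Q + β • A + γ • B) := by
      simp only [smul_add, smul_smul, hα, hβ, hγ, mul_div_cancel₀ _ hQ0]
      rw [hdP, hdQ]
      ext k; fin_cases k <;> simp [cross] <;> ring
    exact smul_right_injective _ hQ0 this
  -- a point of the median from `P`, close to the edge
  set t := 1 / (1 + 2 * |β| + 2 * |γ|) with ht
  have hden : 0 < 1 + 2 * |β| + 2 * |γ| := by positivity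
  have ht0 : 0 < t := by positivity
  have ht1 : t * (1 + 2 * |β| + 2 * |γ|) = 1 := by rw [ht]; field_simp
  have hb := abs_nonneg β
  have hc := abs_nonneg γ
  have htle : t ≤ 1 := by nlinarith
  have hx : t • P + ((1 - t) / 2) • A + ((1 - t) / 2) • B =
      (t * α) • Q + (t * β + (1 - t) / 2) • A + (t * γ + (1 - t) / 2) • B := by
    nth_rewrite 1 [hP]
    module
  refine ⟨t • P + ((1 - t) / 2) • A + ((1 - t) / 2) • B,
    combo_mem_convexHull ht0.le (by linarith) (by linarith) (by ring), ?_, ?_⟩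
  · rw [hx]
    refine combo_mem_convexHull (by positivity) ?_ ?_ ?_
    · nlinarith [neg_abs_le β]
    · nlinarith [neg_abs_le γ]
    · linear_combination t * hsum
  · have : cross (A - (t • P + ((1 - t) / 2) • A + ((1 - t) / 2) • B))
        (B - (t • P + ((1 - t) / 2) • A + ((1 - t) / 2) • B)) = t * dP := by
      rw [hdP]; simp [cross]; ring
    rw [this]; positivity

namespace Mesh

variable {Ω : Set Pt} (M : Mesh Ω)

lemma range_points (K : Fin M.n) (i : Fin 3) : range (M.tri K).points =
    {(M.tri K).points i, (M.tri K).points (i + 1), (M.tri K).points (i + 2)} := by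
  ext x
  simp only [mem_range, mem_insert_iff, mem_singleton_iff]
  constructor
  · rintro ⟨j, rfl⟩
    have : j = i ∨ j = i + 1 ∨ j = i + 2 := by revert i j; decide
    rcases this with h | h | h <;> simp [h]
  · rintro (h | h | h) <;> exact ⟨_, h.symm⟩

lemma range_not_subset {K L : Fin M.n} (h : K ≠ L) :
    ¬ range (M.tri K).points ⊆ range (M.tri L).points := by
  intro hs
  refine h (M.distinct (Set.eq_of_subset_of_ncard_le hs ?_ (finite_range _)))
  show (range (M.tri L).points).ncard ≤ (range (M.tri K).points).ncard
  rw [← image_univ, ← image_univ, ncard_image_of_injective _ (M.tri K).independent.injective,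
    ncard_image_of_injective _ (M.tri L).independent.injective]

/-- Two triangles with a common edge lie on different sides of it. -/
lemma cross_mul_cross_neg {K L : Fin M.n} (hKL : K ≠ L) {i j : Fin 3} {A B : Pt}
    (hK : range (M.tri K).points = {(M.tri K).points i, A, B})
    (hL : range (M.tri L).points = {(M.tri L).points j, A, B})
    (h0 : cross (A - (M.tri K).points i) (B - (M.tri K).points i) ≠ 0)
    (h1 : cross (A - (M.tri L).points j) (B - (M.tri L).points j) ≠ 0) :
    cross (A - (M.tri K).points i) (B - (M.tri K).points i) *
      cross (A - (M.tri L).points j) (B - (M.tri L).points j) < 0 := by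
  refine lt_of_le_of_ne (not_lt.1 fun hpos => ?_) (mul_ne_zero h0 h1)
  obtain ⟨x, hxK, hxL, hx⟩ := exists_mem_convexHull_of_cross_mul_pos hpos
  rw [← hK] at hxK
  rw [← hL] at hxL
  have hx2 := (M.conforming K L hKL).subset ⟨hxK, hxL⟩
  have hsub : range (M.tri K).points ∩ range (M.tri L).points ⊆ {A, B} := by
    rintro y ⟨hy, hy'⟩
    rw [hK] at hy
    rcases hy with rfl | hy
    · exfalso
      refine M.range_not_subset hKL ?_
      rw [hK]
      rintro z (rfl | hz)
      · exact hy'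
      · rw [hL]; exact Or.inr hz
    · exact hy
  have hx3 := convexHull_mono hsub hx2
  rw [convexHull_pair] at hx3
  obtain ⟨a, b, -, -, hab, rfl⟩ := hx3
  apply hx
  have ha : a = 1 - b := by linarith
  subst ha
  simp [cross]; ring

lemma edge_cases {K L : Fin M.n} {i j : Fin 3} (he : M.edge K i = M.edge L j) :
    ((M.tri L).points (j + 1) = (M.tri K).points (i + 1) ∧
      (M.tri L).points (j + 2) = (M.tri K).points (i + 2)) ∨
    ((M.tri L).points (j + 1) = (M.tri K).points (i + 2) ∧
      (M.tri L).points (j + 2) = (M.tri K).points (i + 1)) := by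
  rw [edge, edge, Sym2.eq_iff] at he
  rcases he with ⟨h1, h2⟩ | ⟨h1, h2⟩
  · exact Or.inl ⟨h1.symm, h2.symm⟩
  · exact Or.inr ⟨h2.symm, h1.symm⟩

lemma len_congr {K L : Fin M.n} {i j : Fin 3} (he : M.edge K i = M.edge L j) :
    M.len K i = M.len L j := by
  rcases M.edge_cases he with ⟨h1, h2⟩ | ⟨h1, h2⟩
  · rw [len, len, h1, h2]
  · rw [len, len, h1, h2, dist_comm]

lemma mid_congr {K L : Fin M.n} {i j : Fin 3} (he : M.edge K i = M.edge L j) :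
    M.mid K i = M.mid L j := by
  rcases M.edge_cases he with ⟨h1, h2⟩ | ⟨h1, h2⟩
  · rw [mid, mid, h1, h2]
  · rw [mid, mid, h1, h2, midpoint_comm]

lemma mid_mem_edgeSet (K : Fin M.n) (i : Fin 3) : M.mid K i ∈ M.edgeSet K i :=
  midpoint_mem_segment _ _

/-- The outward normals of two triangles on their common edge are opposite. -/
lemma inner_normal_eq_neg {K L : Fin M.n} (hKL : K ≠ L) {i j : Fin 3}
    (he : M.edge K i = M.edge L j) (v : Pt) :
    inner ℝ v (M.normal K i) = - inner ℝ v (M.normal L j) := by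
  have key : M.len K i * inner ℝ v (M.normal K i) = - (M.len L j * inner ℝ v (M.normal L j)) := by
    rw [M.len_mul_inner_normal, M.len_mul_inner_normal]
    have hK := M.range_points K i
    have hL := M.range_points L j
    have hdK := triDet_eq_cross (M.tri K) i
    have hdL := triDet_eq_cross (M.tri L) j
    have nK := triDet_ne_zero (M.tri K)
    have nL := triDet_ne_zero (M.tri L)
    have hsign : ∀ {a b : ℝ}, a * b < 0 →
        (SignType.sign a : ℝ) = - (SignType.sign b : ℝ) := by
      intro a b hab
      rcases mul_neg_iff.1 hab with ⟨h1, h2⟩ | ⟨h1, h2⟩ <;> simp [h1, h2]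
    rcases M.edge_cases he with ⟨h1, h2⟩ | ⟨h1, h2⟩
    · rw [h1, h2] at hL hdL
      have := M.cross_mul_cross_neg hKL hK hL (hdK ▸ nK) (hdL ▸ nL)
      rw [← hdK, ← hdL] at this
      rw [h1, h2, hsign this]; ring
    · rw [h1, h2] at hL hdL
      have hdL' : cross ((M.tri K).points (i + 1) - (M.tri L).points j)
          ((M.tri K).points (i + 2) - (M.tri L).points j) = - triDet (M.tri L) := by
        rw [hdL]; simp only [cross]; ring
      rw [pair_comm] at hL
      have := M.cross_mul_cross_neg hKL hK hL (hdK ▸ nK) (by rw [hdL']; exact neg_ne_zero.2 nL)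
      rw [← hdK, hdL'] at this
      rw [h1, h2, hsign this, Left.sign_neg]
      simp [cross]; ring
  rw [M.len_congr he, ← mul_neg] at key
  exact mul_left_cancel₀ (M.len_pos L j).ne' key

lemma normal_ne_zero (K : Fin M.n) (i : Fin 3) : M.normal K i ≠ 0 := by
  refine smul_ne_zero (inv_ne_zero ((M.tri K).height_pos i).ne') (sub_ne_zero.2 fun h => ?_)
  exact (M.tri K).ne_altitudeFoot i h.symm

/-- An edge belongs to at most two triangles. -/
lemma eq_of_edge_eq {K L L' : Fin M.n} {i j j' : Fin 3} (hL : L ≠ K) (hL' : L' ≠ K)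
    (h : M.edge L j = M.edge K i) (h' : M.edge L' j' = M.edge K i) : L = L' := by
  by_contra hne
  have h1 := M.inner_normal_eq_neg hL h (M.normal K i)
  have h2 := M.inner_normal_eq_neg hL' h' (M.normal K i)
  have h3 := M.inner_normal_eq_neg hne (h.trans h'.symm) (M.normal K i)
  have : inner ℝ (M.normal K i) (M.normal K i) = (0 : ℝ) := by linarith
  exact M.normal_ne_zero K i (inner_self_eq_zero.1 this)

lemma edge_injective (K : Fin M.n) : Function.Injective (M.edge K) := by
  intro i j h
  have inj := (M.tri K).independent.injective
  rcases M.edge_cases h with ⟨h1, h2⟩ | ⟨h1, h2⟩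
  · exact (add_right_cancel (inj h1)).symm
  · have a := inj h1
    have b := inj h2
    clear h h1 h2
    revert i j; decide

/-! ### Sums over edges -/

lemma mem_nbrs {K : Fin M.n} {e : Fin 3 × Fin M.n} :
    e ∈ M.nbrs K ↔ e.2 ≠ K ∧ ∃ j, M.edge e.2 j = M.edge K e.1 := by
  simp [nbrs]

lemma mem_intEdges {e : (Fin M.n × Fin 3) × (Fin M.n × Fin 3)} :
    e ∈ M.intEdges ↔ e.1.1 < e.2.1 ∧ M.edge e.1.1 e.1.2 = M.edge e.2.1 e.2.2 := by
  simp [intEdges]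

open scoped Classical in
/-- The pairs of different triangles with a common edge, in both orders. -/
def adjPairs : Finset ((Fin M.n × Fin 3) × (Fin M.n × Fin 3)) :=
  Finset.univ.filter fun e => e.1.1 ≠ e.2.1 ∧ M.edge e.1.1 e.1.2 = M.edge e.2.1 e.2.2

lemma mem_adjPairs {e : (Fin M.n × Fin 3) × (Fin M.n × Fin 3)} :
    e ∈ M.adjPairs ↔ e.1.1 ≠ e.2.1 ∧ M.edge e.1.1 e.1.2 = M.edge e.2.1 e.2.2 := by
  simp [adjPairs]

lemma sum_nbrs_eq_sum_adjPairs (φ : Fin M.n → Fin 3 → Fin M.n → ℝ) :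
    ∑ K, ∑ e ∈ M.nbrs K, φ K e.1 e.2 = ∑ e ∈ M.adjPairs, φ e.1.1 e.1.2 e.2.1 := by
  rw [Finset.sum_sigma']
  symm
  refine Finset.sum_bij (fun e _ => ⟨e.1.1, (e.1.2, e.2.1)⟩) ?_ ?_ ?_ ?_
  · intro e he
    rw [mem_adjPairs] at he
    exact Finset.mem_sigma.2 ⟨Finset.mem_univ _, M.mem_nbrs.2 ⟨he.1.symm, e.2.2, he.2.symm⟩⟩
  · rintro ⟨⟨K, i⟩, ⟨L, j⟩⟩ he ⟨⟨K', i'⟩, ⟨L', j'⟩⟩ he' h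
    rw [mem_adjPairs] at he he'
    simp only [Sigma.mk.injEq, heq_eq_eq, Prod.mk.injEq] at h
    obtain ⟨rfl, rfl, rfl⟩ := h
    have := M.edge_injective L (he.2.symm.trans he'.2)
    simp only at this
    rw [this]
  · rintro ⟨K, i, L⟩ he
    obtain ⟨h1, j, hj⟩ := M.mem_nbrs.1 (Finset.mem_sigma.1 he).2
    exact ⟨((K, i), (L, j)), M.mem_adjPairs.2 ⟨h1.symm, hj.symm⟩, rfl⟩
  · intros; rfl

lemma sum_adjPairs_swap (Φ : (Fin M.n × Fin 3) × (Fin M.n × Fin 3) → ℝ) :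
    ∑ e ∈ M.adjPairs, Φ e = ∑ e ∈ M.adjPairs, Φ e.swap := by
  refine Finset.sum_nbij' Prod.swap Prod.swap ?_ ?_ ?_ ?_ ?_ <;>
    simp +contextual [mem_adjPairs, eq_comm]

/-- Double sums over triangles and their neighbours may be rearranged by exchanging the two
triangles of each interior edge. -/
lemma sum_nbrs_swap (φ ψ : Fin M.n → Fin 3 → Fin M.n → ℝ)
    (h : ∀ K i L j, K ≠ L → M.edge K i = M.edge L j → φ K i L = ψ L j K) :
    ∑ K, ∑ e ∈ M.nbrs K, φ K e.1 e.2 = ∑ K, ∑ e ∈ M.nbrs K, ψ K e.1 e.2 := by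
  rw [sum_nbrs_eq_sum_adjPairs, sum_nbrs_eq_sum_adjPairs, sum_adjPairs_swap]
  refine Finset.sum_congr rfl fun e he => ?_
  rw [mem_adjPairs] at he
  exact h _ _ _ _ he.1.symm he.2.symm

lemma sum_nbrs_eq_sum_intEdges (φ : Fin M.n → Fin 3 → Fin M.n → ℝ) :
    ∑ K, ∑ e ∈ M.nbrs K, φ K e.1 e.2 =
      ∑ e ∈ M.intEdges, (φ e.1.1 e.1.2 e.2.1 + φ e.2.1 e.2.2 e.1.1) := by
  classical
  rw [sum_nbrs_eq_sum_adjPairs, Finset.sum_add_distrib,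
    ← Finset.sum_filter_add_sum_filter_not _ (fun e => e.1.1 < e.2.1)]
  congr 1
  · refine Finset.sum_congr ?_ fun _ _ => rfl
    ext e
    simp only [Finset.mem_filter, mem_adjPairs, mem_intEdges]
    exact ⟨fun h => ⟨h.2, h.1.2⟩, fun h => ⟨⟨h.1.ne, h.2⟩, h.1⟩⟩
  · refine Finset.sum_nbij' Prod.swap Prod.swap ?_ ?_ ?_ ?_ ?_
    · intro e he
      simp only [Finset.mem_filter, mem_adjPairs] at he
      exact M.mem_intEdges.2 ⟨lt_of_le_of_ne (not_lt.1 he.2) he.1.1.symm, he.1.2.symm⟩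
    · intro e he
      simp only [Finset.mem_filter, mem_adjPairs]
      rw [mem_intEdges] at he
      exact ⟨⟨he.1.ne', he.2.symm⟩, not_lt.2 he.1.le⟩
    all_goals simp

/-- The sum over the edges of a triangle of a quantity that vanishes on exterior edges. -/
lemma sum_eq_sum_nbrs (K : Fin M.n) (F : Fin 3 → ℝ) (hF : ∀ i, M.IsExt K i → F i = 0) :
    ∑ i, F i = ∑ e ∈ M.nbrs K, F e.1 := by
  classical
  rw [← Finset.sum_filter_of_ne (p := fun i => ¬ M.IsExt K i)
    (fun i _ hi he => hi (hF i he))]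
  symm
  refine Finset.sum_bij (fun e _ => e.1) ?_ ?_ ?_ (fun _ _ => rfl)
  · intro e he
    obtain ⟨h1, j, hj⟩ := M.mem_nbrs.1 he
    exact Finset.mem_filter.2 ⟨Finset.mem_univ _, fun hx => h1 (hx _ _ hj)⟩
  · rintro ⟨i, L⟩ he ⟨i', L'⟩ he' h
    obtain ⟨h1, j, hj⟩ := M.mem_nbrs.1 he
    obtain ⟨h1', j', hj'⟩ := M.mem_nbrs.1 he'
    simp only at h h1 hj h1' hj'
    subst h
    rw [M.eq_of_edge_eq h1 h1' hj hj']
  · intro i hi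
    have := (Finset.mem_filter.1 hi).2
    simp only [IsExt, not_forall] at this
    obtain ⟨L, j, hj, hL⟩ := this
    exact ⟨(i, L), M.mem_nbrs.2 ⟨hL, j, hj⟩, rfl⟩

/-- A quantity on the edges of the triangles that vanishes on exterior edges and takes opposite
values on the two sides of interior edges has zero sum. -/
lemma sum_sum_eq_zero (F : Fin M.n → Fin 3 → ℝ) (hF : ∀ K i, M.IsExt K i → F K i = 0)
    (hF' : ∀ K i L j, K ≠ L → M.edge K i = M.edge L j → F K i = - F L j) :
    ∑ K, ∑ i, F K i = 0 := by
  have h1 : ∑ K, ∑ i, F K i = ∑ K, ∑ e ∈ M.nbrs K, F K e.1 :=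
    Finset.sum_congr rfl fun K _ => M.sum_eq_sum_nbrs K _ (hF K)
  have h2 := M.sum_nbrs_swap (fun K i _ => F K i) (fun K i _ => - F K i) hF'
  simp only [Finset.sum_neg_distrib] at h2
  linarith

end Mesh

/-! ### Areas and integrals over the mesh -/

/-- The area of the triangle with vertices `(0, 0)`, `(1, 0)`, `(0, 1)`. -/
def refArea : ℝ := volume.real (convexHull ℝ
  ({0, EuclideanSpace.single 0 1, EuclideanSpace.single 1 1} : Set Pt))

namespace Mesh

variable {Ω : Set Pt} (M : Mesh Ω)

lemma isCompact_cell (K : Fin M.n) : IsCompact (M.cell K) :=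
  (finite_range _).isCompact_convexHull (𝕜 := ℝ)

lemma convex_cell (K : Fin M.n) : Convex ℝ (M.cell K) := convex_convexHull _ _

lemma interior_cell_nonempty (K : Fin M.n) : (interior (M.cell K)).Nonempty := by
  rw [cell, interior_convexHull_nonempty_iff_affineSpan_eq_top]
  exact (M.tri K).independent.affineSpan_eq_top_iff_card_eq_finrank_add_one.2 (by simp)

lemma measure_cell_ne_top (K : Fin M.n) : volume (M.cell K) ≠ ⊤ :=
  (M.isCompact_cell K).measure_lt_top.ne

lemma measure_cell_ne_zero (K : Fin M.n) : volume (M.cell K) ≠ 0 :=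
  (Measure.measure_pos_of_nonempty_interior _ (M.interior_cell_nonempty K)).ne'

instance (K : Fin M.n) : IsFiniteMeasure (volume.restrict (M.cell K)) :=
  ⟨by simpa using (M.isCompact_cell K).measure_lt_top⟩

instance (K : Fin M.n) : NeZero (volume.restrict (M.cell K)) :=
  ⟨by simpa using M.measure_cell_ne_zero K⟩

lemma area_pos (K : Fin M.n) : 0 < M.area K :=
  ENNReal.toReal_pos (M.measure_cell_ne_zero K) (M.measure_cell_ne_top K)

open scoped Pointwise in
/-- The value of the constant `refArea`, which is `1 / 2`, is not needed: it is common to all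
triangles. -/
lemma area_eq (K : Fin M.n) : M.area K = refArea * |triDet (M.tri K)| := by
  set t := M.tri K
  set a := t.points 1 - t.points 0 with ha
  set b := t.points 2 - t.points 0 with hb
  let B := (EuclideanSpace.basisFun (Fin 2) ℝ).toBasis
  let A : Pt →ₗ[ℝ] Pt := Matrix.toLin B B !![a 0, b 0; a 1, b 1]
  have hdet : LinearMap.det A = triDet t := by
    rw [LinearMap.det_toLin, Matrix.det_fin_two_of, triDet, cross]; ring
  have hB : ∀ i, B i = EuclideanSpace.single i 1 := fun i => by simp [B]
  have h0 : A (EuclideanSpace.single 0 1) = a := by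
    rw [← hB, Matrix.toLin_self]
    ext k; fin_cases k <;> simp [hB]
  have h1 : A (EuclideanSpace.single 1 1) = b := by
    rw [← hB, Matrix.toLin_self]
    ext k; fin_cases k <;> simp [hB]
  have hcell : M.cell K = (fun x => t.points 0 + x) '' (A '' convexHull ℝ
      ({0, EuclideanSpace.single 0 1, EuclideanSpace.single 1 1} : Set Pt)) := by
    rw [A.image_convexHull, image_insert_eq, image_pair, map_zero, h0, h1]
    have := convexHull_vadd (𝕜 := ℝ) (t.points 0) ({0, a, b} : Set Pt)
    have h2 : (fun x => t.points 0 + x) '' convexHull ℝ ({0, a, b} : Set Pt) =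
        t.points 0 +ᵥ convexHull ℝ ({0, a, b} : Set Pt) := rfl
    rw [h2, ← this, cell, M.range_points K 0, ← Set.image_vadd, image_insert_eq, image_pair]
    simp [ha, hb, t]
  rw [area, hcell, Measure.real, image_add_left, measure_preimage_add,
    Measure.addHaar_image_linearMap, hdet,
    ENNReal.toReal_mul, ENNReal.toReal_ofReal (abs_nonneg _), mul_comm]
  rfl

lemma aedisjoint_cell {K L : Fin M.n} (h : K ≠ L) :
    AEDisjoint volume (M.cell K) (M.cell L) := by
  rw [AEDisjoint, cell, cell, M.conforming K L h]
  obtain ⟨x, ⟨i, rfl⟩, hi⟩ := not_subset.1 (M.range_not_subset h)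
  have hsub : range (M.tri K).points ∩ range (M.tri L).points ⊆
      {(M.tri K).points (i + 1), (M.tri K).points (i + 2)} := by
    rintro y ⟨hy, hy'⟩
    rw [M.range_points K i] at hy
    rcases hy with rfl | hy
    · exact absurd hy' hi
    · exact hy
  refine measure_mono_null ((convexHull_mono hsub).trans (convexHull_subset_affineSpan _))
    (Measure.addHaar_affineSubspace _ _ fun htop => ?_)
  have h1 := (collinear_pair ℝ ((M.tri K).points (i + 1)) ((M.tri K).points (i + 2))).finrank_le_one
  rw [← direction_affineSpan, htop, AffineSubspace.direction_top, finrank_top] at h1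
  simp at h1

/-- The boundary of a triangle is negligible, and its interior lies in the interior of `closure Ω`,
which is `Ω`. -/
lemma cell_ae_le (hΩ : interior (closure Ω) = Ω) (K : Fin M.n) : M.cell K ≤ᵐ[volume] Ω := by
  have h1 : (interior (M.cell K) : Set Pt) =ᵐ[volume] M.cell K :=
    interior_ae_eq_of_null_frontier ((M.convex_cell K).addHaar_frontier volume)
  have : M.cell K ⊆ closure Ω := M.covers ▸ subset_iUnion M.cell K
  filter_upwards [h1.symm.le] with x hx hxK
  exact hΩ.subset (interior_mono this (hx hxK))

variable {M} in
lemma restrict_cell_le (hΩ : interior (closure Ω) = Ω) (K : Fin M.n) :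
    volume.restrict (M.cell K) ≤ volume.restrict Ω :=
  Measure.restrict_mono_ae (M.cell_ae_le hΩ K)

lemma sum_setIntegral_cell_le (hΩ : interior (closure Ω) = Ω) {φ : Pt → ℝ}
    (hφ : IntegrableOn φ Ω) (h0 : ∀ x, 0 ≤ φ x) :
    ∑ K, ∫ x in M.cell K, φ x ≤ ∫ x in Ω, φ x := by
  have hle : volume.restrict (⋃ K, M.cell K) ≤ volume.restrict Ω := by
    refine Measure.restrict_mono_ae ?_
    filter_upwards [ae_all_iff.2 (M.cell_ae_le hΩ)] with x hx hxU
    obtain ⟨K, hK⟩ := mem_iUnion.1 hxU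
    exact hx K hK
  have := integral_iUnion_ae (f := φ) (μ := volume) (s := M.cell)
    (fun K => (M.isCompact_cell K).measurableSet.nullMeasurableSet)
    (fun K L h => M.aedisjoint_cell h) (Integrable.mono_measure hφ hle)
  rw [← tsum_fintype (L := .unconditional _), ← this]
  exact integral_mono_measure hle (Filter.Eventually.of_forall h0) hφ

lemma sum_area_le (hΩ : interior (closure Ω) = Ω) (hb : Bornology.IsBounded Ω) :
    ∑ K, M.area K ≤ volume.real Ω := by
  have := M.sum_setIntegral_cell_le hΩ (φ := fun _ => 1)
    (integrableOn_const hb.measure_lt_top.ne) (fun _ => zero_le_one)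
  simpa [area] using this

lemma area_mul_norm_projP0_sq_le {F : Type} [NormedAddCommGroup F] [InnerProductSpace ℝ F]
    [CompleteSpace F] {g : Pt → F} {K : Fin M.n}
    (hg : MemLp g 2 (volume.restrict (M.cell K))) :
    M.area K * ‖M.projP0 g K‖ ^ 2 ≤ ∫ x in M.cell K, ‖g x‖ ^ 2 := by
  have h := ConvexOn.map_average_le (μ := volume.restrict (M.cell K)) (f := g)
    (g := fun y : F => ‖y‖ ^ 2) (s := univ)
    ((convexOn_univ_norm).pow (fun _ _ => norm_nonneg _) 2) (by fun_prop) isClosed_univ (by simp)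
    (hg.integrable (by norm_num)) (hg.integrable_norm_pow (p := 2) (by norm_num))
  rw [setAverage_eq (μ := volume) (f := fun x => ‖g x‖ ^ 2), smul_eq_mul] at h
  calc M.area K * ‖M.projP0 g K‖ ^ 2
      ≤ M.area K * ((volume.real (M.cell K))⁻¹ * ∫ x in M.cell K, ‖g x‖ ^ 2) :=
        mul_le_mul_of_nonneg_left h (M.area_pos K).le
    _ = _ := by
        have : volume.real (M.cell K) ≠ 0 := (M.area_pos K).ne'
        rw [← mul_assoc, area, mul_inv_cancel₀ this, one_mul]

/-- The projection on `P₀` does not increase the `L²` norm. -/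
lemma sum_area_mul_norm_projP0_sq_le (hΩ : interior (closure Ω) = Ω)
    {F : Type} [NormedAddCommGroup F] [InnerProductSpace ℝ F] [CompleteSpace F] {g : Pt → F}
    (hg : MemLp g 2 (volume.restrict Ω)) :
    ∑ K, M.area K * ‖M.projP0 g K‖ ^ 2 ≤ (eLpNorm g 2 (volume.restrict Ω)).toReal ^ 2 := by
  have h1 : ∑ K, M.area K * ‖M.projP0 g K‖ ^ 2 ≤ ∫ x in Ω, ‖g x‖ ^ 2 :=
    (Finset.sum_le_sum fun K _ => M.area_mul_norm_projP0_sq_le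
      (hg.mono_measure (restrict_cell_le hΩ K))).trans
      (M.sum_setIntegral_cell_le hΩ (hg.integrable_norm_pow (by norm_num)) fun _ => by positivity)
  refine h1.trans_eq ?_
  have hnn : 0 ≤ ∫ x in Ω, ‖g x‖ ^ 2 := integral_nonneg fun _ => by positivity
  rw [hg.eLpNorm_eq_integral_rpow_norm (by norm_num) (by norm_num),
    ENNReal.toReal_ofReal (by positivity)]
  have : (2 : ℝ≥0∞).toReal = (2 : ℕ) := by norm_num
  simp only [this, Real.rpow_natCast]
  rw [← Real.rpow_natCast, ← Real.rpow_mul hnn]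
  norm_num

lemma le_projP0 {g : Pt → ℝ} {K : Fin M.n} {b : ℝ}
    (hg : Integrable g (volume.restrict (M.cell K)))
    (h : ∀ᵐ x ∂(volume.restrict (M.cell K)), b ≤ g x) : b ≤ M.projP0 g K := by
  have := integral_mono_ae (integrable_const b) hg h
  rw [projP0, setAverage_eq, smul_eq_mul, ← div_eq_inv_mul]
  refine (le_div_iff₀ (M.area_pos K)).2 ?_
  simpa [area, mul_comm] using this

lemma projP0_le {g : Pt → ℝ} {K : Fin M.n} {b : ℝ}
    (hg : Integrable g (volume.restrict (M.cell K)))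
    (h : ∀ᵐ x ∂(volume.restrict (M.cell K)), g x ≤ b) : M.projP0 g K ≤ b := by
  have := integral_mono_ae hg (integrable_const b) h
  rw [projP0, setAverage_eq, smul_eq_mul, ← div_eq_inv_mul]
  refine (div_le_iff₀ (M.area_pos K)).2 ?_
  simpa [area, mul_comm] using this

/-! ### Piecewise affine functions -/

lemma continuous_affine_pt {F : Type} [NormedAddCommGroup F] [NormedSpace ℝ F]
    (f : Pt →ᵃ[ℝ] F) : Continuous f :=
  AffineMap.continuous_linear_iff.1 f.linear.continuous_of_finiteDimensional

/-- A continuous piecewise defined function of zero `L²` norm vanishes. -/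
lemma eq_zero_of_l2_self_eq_zero {F : Type} [NormedAddCommGroup F] [InnerProductSpace ℝ F]
    {w : Fin M.n → Pt → F} (hw : ∀ K, Continuous (w K)) (h : M.l2 w w = 0) {K : Fin M.n} {x : Pt}
    (hx : x ∈ M.cell K) : w K x = 0 := by
  have hK : ∫ x in M.cell K, inner ℝ (w K x) (w K x) = 0 :=
    (Finset.sum_eq_zero_iff_of_nonneg
      (fun K _ => integral_nonneg fun x => real_inner_self_nonneg)).1 h K (Finset.mem_univ _)
  have hc : Continuous fun x => inner ℝ (w K x) (w K x) := (hw K).inner (hw K)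
  rw [integral_eq_zero_iff_of_nonneg (fun x => real_inner_self_nonneg)
    (hc.continuousOn.integrableOn_compact (M.isCompact_cell K))] at hK
  have h1 : ∀ᵐ y ∂(volume.restrict (interior (M.cell K))), w K y = 0 := by
    refine ae_mono (Measure.restrict_mono interior_subset le_rfl) ?_
    filter_upwards [hK] with y hy
    exact inner_self_eq_zero.1 hy
  have h2 : EqOn (w K) 0 (interior (M.cell K)) :=
    Measure.eqOn_open_of_ae_eq h1 isOpen_interior (hw K).continuousOn continuousOn_const
  have h3 : x ∈ closure (interior (M.cell K)) := by
    rw [(M.convex_cell K).closure_interior_eq_closure_of_nonempty_interior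
      (M.interior_cell_nonempty K)]
    exact subset_closure hx
  exact h2.closure (hw K) continuous_const h3

lemma edgeSet_subset_cell (K : Fin M.n) (i : Fin 3) : M.edgeSet K i ⊆ M.cell K :=
  (convex_convexHull ℝ _).segment_subset (subset_convexHull _ _ (mem_range_self _))
    (subset_convexHull _ _ (mem_range_self _))

lemma l2_pc_pc {F : Type} [NormedAddCommGroup F] [InnerProductSpace ℝ F]
    (v w : Fin M.n → F) :
    M.l2 (M.pc v) (M.pc w) = ∑ K, M.area K * inner ℝ (v K) (w K) := by
  simp [l2, pc, area]

lemma l2norm_pc_sq {F : Type} [NormedAddCommGroup F] [InnerProductSpace ℝ F] (v : Fin M.n → F) :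
    M.l2norm (M.pc v) ^ 2 = ∑ K, M.area K * ‖v K‖ ^ 2 := by
  have : M.l2 (M.pc v) (M.pc v) = ∑ K, M.area K * ‖v K‖ ^ 2 := by
    simp [l2_pc_pc]
  rw [l2norm, Real.sq_sqrt, this]
  rw [this]
  exact Finset.sum_nonneg fun K _ => mul_nonneg (M.area_pos K).le (by positivity)

lemma l2norm_congr {F : Type} [NormedAddCommGroup F] [InnerProductSpace ℝ F]
    {v w : Fin M.n → Pt → F} (h : ∀ K, ∀ x ∈ M.cell K, v K x = w K x) :
    M.l2norm v = M.l2norm w := by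
  rw [l2norm, l2norm, l2, l2]
  congr 1
  refine Finset.sum_congr rfl fun K _ => setIntegral_congr_fun
    (M.isCompact_cell K).measurableSet fun x hx => ?_
  simp only [h K x hx]

/-! ### Upwind convection by a discretely divergence free field -/

variable {M} in
lemma IsRT0.flux_eq_neg {v : M.P1dv} (hv : M.IsRT0 v) {K L : Fin M.n} (hKL : K ≠ L)
    {i j : Fin 3} (he : M.edge K i = M.edge L j) : M.flux v K i = - M.flux v L j := by
  rcases lt_or_gt_of_ne hKL with h | h
  · have := hv.int_normal ((K, i), (L, j)) (M.mem_intEdges.2 ⟨h, he⟩) _ (M.mid_mem_edgeSet K i)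
    rw [flux, flux, this, ← M.mid_congr he, M.inner_normal_eq_neg hKL he]
  · have := hv.int_normal ((L, j), (K, i)) (M.mem_intEdges.2 ⟨h, he.symm⟩) _
      (M.mid_mem_edgeSet L j)
    rw [flux, flux, this, ← M.mid_congr he, M.inner_normal_eq_neg hKL he]

variable {M} in
lemma IsRT0.flux_eq_zero {v : M.P1dv} (hv : M.IsRT0 v) {K : Fin M.n} {i : Fin 3}
    (he : M.IsExt K i) : M.flux v K i = 0 :=
  hv.ext_normal K i he _ (M.mid_mem_edgeSet K i)

variable {M} in
/-- A field with vanishing normal component on the boundary has a divergence of zero mean. -/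
lemma IsRT0.sum_area_mul_divRT {v : M.P1dv} (hv : M.IsRT0 v) :
    ∑ K, M.area K * M.divRT v K = 0 := by
  have h := M.sum_sum_eq_zero (fun K i => M.len K i * M.flux v K i)
    (fun K i he => by simp only [hv.flux_eq_zero he, mul_zero])
    (fun K i L j hKL he => by
      simp only [hv.flux_eq_neg hKL he, M.len_congr he, mul_neg])
  simp only [M.sum_len_flux] at h
  have : ∀ K, M.area K * M.divRT v K =
      2 * refArea * (|triDet (M.tri K)| / 2 * M.divRT v K) := fun K => by
    rw [M.area_eq]; ring
  simp only [this, ← Finset.mul_sum, h, mul_zero]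

variable {M} in
lemma IsRT0.sum_nbrs_flux {v : M.P1dv} (hv : M.IsRT0 v) (hdiv : M.divRT v = 0) (K : Fin M.n) :
    ∑ e ∈ M.nbrs K, M.len K e.1 * M.flux v K e.1 = 0 := by
  rw [← M.sum_eq_sum_nbrs K (fun i => M.len K i * M.flux v K i)
    (fun i he => by simp only [hv.flux_eq_zero he, mul_zero]), M.sum_len_flux, hdiv]
  simp

variable {M} in
/-- The nonconservative form of the convection operator for a divergence free field. -/
lemma IsRT0.area_mul_convh {v : M.P1dv} (hv : M.IsRT0 v) (hdiv : M.divRT v = 0) (q : M.P0)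
    (K : Fin M.n) : M.area K * M.convh v q K =
      ∑ e ∈ M.nbrs K, M.len K e.1 * (min (M.flux v K e.1) 0 * (q e.2 - q K)) := by
  have h := hv.sum_nbrs_flux hdiv K
  have h2 : ∑ e ∈ M.nbrs K, M.len K e.1 *
      (max (M.flux v K e.1) 0 * q K + min (M.flux v K e.1) 0 * q e.2) =
      ∑ e ∈ M.nbrs K, M.len K e.1 * (min (M.flux v K e.1) 0 * (q e.2 - q K)) +
      q K * ∑ e ∈ M.nbrs K, M.len K e.1 * M.flux v K e.1 := by
    rw [Finset.mul_sum, ← Finset.sum_add_distrib]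
    refine Finset.sum_congr rfl fun e _ => ?_
    linear_combination M.len K e.1 * q K * max_add_min (M.flux v K e.1) 0
  rw [convh, h2, h, ← mul_assoc, mul_one_div_cancel (M.area_pos K).ne']
  ring

lemma area_mul_laph (q : M.P0) (K : Fin M.n) :
    M.area K * M.laph q K = ∑ e ∈ M.nbrs K, M.tau K e.1 e.2 * (q e.2 - q K) := by
  rw [laph, ← mul_assoc, mul_one_div_cancel (M.area_pos K).ne', one_mul]

lemma tau_nonneg (K : Fin M.n) (i : Fin 3) (L : Fin M.n) : 0 ≤ M.tau K i L :=
  div_nonneg dist_nonneg dist_nonneg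

lemma tau_congr {K L : Fin M.n} {i j : Fin 3} (he : M.edge K i = M.edge L j) :
    M.tau K i L = M.tau L j K := by
  rw [tau, tau, M.len_congr he, dist_comm]

variable {M} in
/-- The discrete maximum principle: an upper bound `b` passes to the next time level if the source
term pulls the solution down to `b`. -/
lemma IsRT0.le_of_implicit_step {v : M.P1dv} (hv : M.IsRT0 v) (hdiv : M.divRT v = 0)
    {q q' r : M.P0} {k d μ b : ℝ} (hk : 0 < k) (hd : 0 ≤ d) (hμ : 0 ≤ μ) (hq : ∀ K, q K ≤ b)
    (h : ∀ K, (q' K - q K) / k - d * M.laph q' K = r K - M.convh v q' K)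
    (hr : ∀ K, r K ≤ μ * (b - q' K)) (K : Fin M.n) : q' K ≤ b := by
  have : Nonempty (Fin M.n) := ⟨K⟩
  -- at a maximum of `q'`, the laplacian is nonpositive and the convection term nonnegative
  obtain ⟨J, hJ⟩ := Finite.exists_max q'
  refine (hJ K).trans (not_lt.1 fun hb => ?_)
  have hA := M.area_pos J
  have h1 : M.laph q' J ≤ 0 := by
    refine nonpos_of_mul_nonpos_right ?_ hA
    rw [M.area_mul_laph]
    exact Finset.sum_nonpos fun e _ =>
      mul_nonpos_of_nonneg_of_nonpos (M.tau_nonneg _ _ _) (sub_nonpos.2 (hJ _))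
  have h2 : 0 ≤ M.convh v q' J := by
    refine nonneg_of_mul_nonneg_right ?_ hA
    rw [hv.area_mul_convh hdiv]
    exact Finset.sum_nonneg fun e _ => mul_nonneg (M.len_pos _ _).le
      (mul_nonneg_of_nonpos_of_nonpos (min_le_right _ _) (sub_nonpos.2 (hJ _)))
  have h3 := h J
  have h4 := hr J
  have h5 : 0 < (q' J - q J) / k := div_pos (by linarith [hq J]) hk
  have h6 : μ * (b - q' J) ≤ 0 := mul_nonpos_of_nonneg_of_nonpos hμ (by linarith)
  have h7 : d * M.laph q' J ≤ 0 := mul_nonpos_of_nonneg_of_nonpos hd h1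
  linarith

variable {M} in
/-- The discrete minimum principle. -/
lemma IsRT0.ge_of_implicit_step {v : M.P1dv} (hv : M.IsRT0 v) (hdiv : M.divRT v = 0)
    {q q' r : M.P0} {k d μ b : ℝ} (hk : 0 < k) (hd : 0 ≤ d) (hμ : 0 ≤ μ) (hq : ∀ K, b ≤ q K)
    (h : ∀ K, (q' K - q K) / k - d * M.laph q' K = r K - M.convh v q' K)
    (hr : ∀ K, μ * (b - q' K) ≤ r K) (K : Fin M.n) : b ≤ q' K := by
  have := hv.le_of_implicit_step hdiv (q := -q) (q' := -q') (r := -r) (b := -b) hk hd hμ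
    (fun K => neg_le_neg (hq K)) (fun K => ?_) (fun K => ?_) K
  · simpa using this
  · have h1 : M.laph (-q') K = - M.laph q' K := by
      simp only [laph, Pi.neg_apply, ← mul_neg, ← Finset.sum_neg_distrib]
      congr 1
      exact Finset.sum_congr rfl fun e _ => by ring
    have h2 : M.convh v (-q') K = - M.convh v q' K := by
      simp only [convh, Pi.neg_apply, ← mul_neg, ← Finset.sum_neg_distrib]
      congr 1
      exact Finset.sum_congr rfl fun e _ => by ring
    rw [h1, h2]
    simp only [Pi.neg_apply]
    linear_combination - h K
  · have := hr K
    simp only [Pi.neg_apply]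
    linarith

lemma normh_sq (q : M.P0) : M.normh q ^ 2 =
    ∑ e ∈ M.intEdges, M.tau e.1.1 e.1.2 e.2.1 * (q e.2.1 - q e.1.1) ^ 2 :=
  Real.sq_sqrt (Finset.sum_nonneg fun _ _ => mul_nonneg (M.tau_nonneg _ _ _) (sq_nonneg _))

/-- Discrete integration by parts for the laplacian. -/
lemma sum_area_mul_laph_mul (q : M.P0) :
    ∑ K, M.area K * M.laph q K * q K = - M.normh q ^ 2 := by
  have h := M.sum_nbrs_eq_sum_intEdges (fun K i L => M.tau K i L * (q L - q K) * q K)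
  simp only [M.area_mul_laph, Finset.sum_mul]
  rw [h, normh_sq, ← Finset.sum_neg_distrib]
  refine Finset.sum_congr rfl fun e he => ?_
  rw [← M.tau_congr (M.mem_intEdges.1 he).2]
  ring

variable {M} in
/-- The upwind convection operator of a divergence free field is nonnegative. -/
lemma IsRT0.sum_area_mul_convh_mul_nonneg {v : M.P1dv} (hv : M.IsRT0 v) (hdiv : M.divRT v = 0)
    (q : M.P0) : 0 ≤ ∑ K, M.area K * M.convh v q K * q K := by
  have hswap := M.sum_nbrs_swap
    (fun K i L => M.len K i * (min (M.flux v K i) 0 * q L ^ 2))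
    (fun K i _ => M.len K i * (min (-M.flux v K i) 0 * q K ^ 2))
    (fun K i L j hKL he => by
      simp only [hv.flux_eq_neg hKL he, M.len_congr he])
  -- `(b - a) a = (b² - a²) / 2 - (b - a)² / 2`, and the weight of the last square is nonpositive
  have hle : ∑ K, ∑ e ∈ M.nbrs K, (M.len K e.1 * (min (M.flux v K e.1) 0 * q e.2 ^ 2) -
      M.len K e.1 * (min (M.flux v K e.1) 0 * q K ^ 2)) ≤
      2 * ∑ K, M.area K * M.convh v q K * q K := by
    simp only [hv.area_mul_convh hdiv, Finset.sum_mul, Finset.mul_sum]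
    refine Finset.sum_le_sum fun K _ => Finset.sum_le_sum fun e _ => ?_
    have := mul_nonneg (mul_nonneg (M.len_pos K e.1).le
      (neg_nonneg.2 (min_le_right (M.flux v K e.1) 0))) (sq_nonneg (q e.2 - q K))
    linarith
  have hzero : ∑ K, ∑ e ∈ M.nbrs K, (M.len K e.1 * (min (M.flux v K e.1) 0 * q e.2 ^ 2) -
      M.len K e.1 * (min (M.flux v K e.1) 0 * q K ^ 2)) = 0 := by
    simp only [Finset.sum_sub_distrib]
    rw [hswap, ← Finset.sum_sub_distrib]
    refine Finset.sum_eq_zero fun K _ => ?_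
    have h0 := congrArg (fun x => - q K ^ 2 * x) (hv.sum_nbrs_flux hdiv K)
    simp only [Finset.mul_sum, mul_zero] at h0
    rw [← Finset.sum_sub_distrib]
    refine (Finset.sum_congr rfl fun e _ => ?_).trans h0
    have : min (-M.flux v K e.1) 0 - min (M.flux v K e.1) 0 = - M.flux v K e.1 := by
      rcases le_total (M.flux v K e.1) 0 with h | h
      · rw [min_eq_left h, min_eq_right (neg_nonneg.2 h)]; ring
      · rw [min_eq_right h, min_eq_left (neg_nonpos.2 h)]; ring
    linear_combination M.len K e.1 * q K ^ 2 * this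
  linarith

variable {M} in
/-- The energy estimate of one implicit time step. -/
lemma IsRT0.energy_step {v : M.P1dv} (hv : M.IsRT0 v) (hdiv : M.divRT v = 0)
    {q q' r : M.P0} {k d : ℝ} (hk : 0 < k)
    (h : ∀ K, (q' K - q K) / k - d * M.laph q' K = r K - M.convh v q' K) :
    (∑ K, M.area K * q' K ^ 2) / 2 + d * (k * M.normh q' ^ 2) ≤
      (∑ K, M.area K * q K ^ 2) / 2 + k * ∑ K, M.area K * (r K * q' K) := by
  have h1 : ∀ K, M.area K * ((q' K - q K) * q' K) - k * d * (M.area K * M.laph q' K * q' K) =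
      k * (M.area K * (r K * q' K)) - k * (M.area K * M.convh v q' K * q' K) := by
    intro K
    have := h K
    field_simp at this
    linear_combination M.area K * q' K * this
  have h2 := Finset.sum_congr (s₁ := Finset.univ) rfl fun K _ => h1 K
  simp only [Finset.sum_sub_distrib, ← Finset.mul_sum, M.sum_area_mul_laph_mul] at h2
  have h3 : (∑ K, M.area K * q' K ^ 2) / 2 - (∑ K, M.area K * q K ^ 2) / 2 ≤
      ∑ K, M.area K * ((q' K - q K) * q' K) := by
    rw [← sub_div, ← Finset.sum_sub_distrib, Finset.sum_div]
    refine Finset.sum_le_sum fun K _ => ?_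
    nlinarith [mul_nonneg (M.area_pos K).le (sq_nonneg (q' K - q K))]
  have h4 := mul_nonneg hk.le (hv.sum_area_mul_convh_mul_nonneg hdiv q')
  linarith

end Mesh

/-! ### The sources -/

/-- The two bounds on the heat source can hold together only where the mass source is nonnegative.
As the divergence of a discrete velocity has zero mean, the sources of mass and heat vanish. -/
lemma Data.Admissible.sources_ae_eq_zero {D : Data} (hD : D.Admissible) {M : Mesh D.Ω}
    {v : M.P1dv} (hv : M.IsRT0 v) (hdiv : M.divRT v = M.projP0 D.s) (K : Fin M.n) :
    ∀ᵐ x ∂(volume.restrict (M.cell K)), D.s x = 0 ∧ D.sθ x = 0 := by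
  have hle := Mesh.restrict_cell_le (M := M) hD.domain.regular
  have hpos : ∀ᵐ x ∂(volume.restrict D.Ω), 0 ≤ D.s x := by
    filter_upwards [hD.sθ_lo, hD.sθ_hi] with x h1 h2
    have := hD.θlo_lt_θhi
    by_contra hneg
    nlinarith
  have hint : ∀ K, Integrable D.s (volume.restrict (M.cell K)) := fun K =>
    (hD.s_mem.mono_measure (hle K)).integrable (by norm_num)
  have hsum : ∑ K, M.area K * M.projP0 D.s K = 0 := by rw [← hdiv]; exact hv.sum_area_mul_divRT
  have hK := (Finset.sum_eq_zero_iff_of_nonneg fun K _ => mul_nonneg (M.area_pos K).le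
    (M.le_projP0 (hint K) (ae_mono (hle K) hpos))).1 hsum K (Finset.mem_univ _)
  have h0 : ∫ x in M.cell K, D.s x = 0 := by
    have h1 := (mul_eq_zero.1 hK).resolve_left (M.area_pos K).ne'
    rw [Mesh.projP0, setAverage_eq, smul_eq_mul] at h1
    exact (mul_eq_zero.1 h1).resolve_left (inv_ne_zero (M.area_pos K).ne')
  rw [integral_eq_zero_iff_of_nonneg_ae (ae_mono (hle K) hpos) (hint K)] at h0
  filter_upwards [h0, ae_mono (hle K) hD.sθ_lo, ae_mono (hle K) hD.sθ_hi] with x h1 h2 h3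
  have h1 : D.s x = 0 := h1
  rw [h1] at h2 h3
  exact ⟨h1, by linarith⟩

namespace Mesh

variable {Ω : Set Pt} {M : Mesh Ω}

lemma projP0_eq_zero {g : Pt → ℝ} {K : Fin M.n}
    (h : ∀ᵐ x ∂(volume.restrict (M.cell K)), g x = 0) : M.projP0 g K = 0 := by
  rw [projP0, setAverage_eq, integral_eq_zero_of_ae h, smul_zero]

/-! ### The velocity -/

/-- A piecewise constant field as a piecewise affine one. -/
def constP1dv (g : M.P0v) : M.P1dv := fun K => AffineMap.const ℝ Pt (g K)

lemma IsRT0.sub {v w : M.P1dv} (hv : M.IsRT0 v) (hw : M.IsRT0 w) : M.IsRT0 (v - w) where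
  rt0d K i x hx y hy := by
    have h1 := hv.rt0d K i x hx y hy
    have h2 := hw.rt0d K i x hx y hy
    simp only [Pi.sub_apply, AffineMap.coe_sub, inner_sub_left, h1, h2]
  int_normal e he x hx := by
    have h1 := hv.int_normal e he x hx
    have h2 := hw.int_normal e he x hx
    simp only [Pi.sub_apply, AffineMap.coe_sub, inner_sub_left, h1, h2]
  ext_normal K i hK x hx := by
    have h1 := hv.ext_normal K i hK x hx
    have h2 := hw.ext_normal K i hK x hx
    simp only [Pi.sub_apply, AffineMap.coe_sub, inner_sub_left, h1, h2, sub_zero]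

lemma IsProjP1nc.eq_zero {r : M.P1d} (h : M.IsProjP1nc 0 r) {K : Fin M.n} {x : Pt}
    (hx : x ∈ M.cell K) : r K x = 0 := by
  refine M.eq_zero_of_l2_self_eq_zero (w := M.pa r) (fun K => continuous_affine_pt _) ?_ hx
  rw [h.2 r h.1]
  simp [l2, pc]

/-- A piecewise constant field whose discrete divergence vanishes belongs to `RT₀`. -/
lemma isRT0_constP1dv_of_divh_eq {f w : M.P0v} {a b : M.P1d} (ha : M.IsDivh w a)
    (hb : M.IsDivh f b) (hab : ∀ K i, a K (M.mid K i) = b K (M.mid K i)) :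
    M.IsRT0 (constP1dv fun K => f K - w K) where
  rt0d K i x hx y hy := rfl
  int_normal e he x hx := by
    have h := hab e.1.1 e.1.2
    rw [ha.int_val e he, hb.int_val e he] at h
    have h1 := mul_left_cancel₀ (div_pos (mul_pos three_pos (M.len_pos _ _))
      (add_pos (M.area_pos _) (M.area_pos _))).ne' h
    simp only [constP1dv, AffineMap.const_apply, inner_sub_left] at h1 ⊢
    linarith
  ext_normal K i hK x hx := by
    have h := hab K i
    rw [ha.ext_val K i hK, hb.ext_val K i hK] at h
    have h1 := mul_left_cancel₀ (neg_ne_zero.2 (div_pos (mul_pos three_pos (M.len_pos K i))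
      (M.area_pos K)).ne') h
    simp only [constP1dv, AffineMap.const_apply, inner_sub_left]
    linarith

lemma IsProjRT0.eq_of_isRT0 {g : M.P0v} {u : M.P1dv} (hu : M.IsProjRT0 g u)
    (hg : M.IsRT0 (constP1dv g)) {K : Fin M.n} {x : Pt} (hx : x ∈ M.cell K) : u K x = g K := by
  have hψ := hu.1.sub hg
  refine sub_eq_zero.1 (M.eq_zero_of_l2_self_eq_zero (w := M.pa (u - constP1dv g))
    (fun K => continuous_affine_pt _) ?_ hx)
  have h := hu.2 _ hψ
  rw [← sub_eq_zero, l2, l2, ← Finset.sum_sub_distrib] at h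
  rw [← h, l2]
  refine Finset.sum_congr rfl fun K _ => ?_
  have hc : Continuous fun x => (u - constP1dv g) K x := continuous_affine_pt _
  have hcu : Continuous fun x => u K x := continuous_affine_pt _
  rw [← integral_sub]
  · simp only [pa, pc, ← inner_sub_left]
    rfl
  · exact (hcu.inner hc).continuousOn.integrableOn_compact (M.isCompact_cell K)
  · exact (continuous_const.inner hc).continuousOn.integrableOn_compact (M.isCompact_cell K)

lemma divRT_eq_zero_of_eq_const {g : M.P0v} {u : M.P1dv}
    (h : ∀ K, ∀ x ∈ M.cell K, u K x = g K) : M.divRT u = 0 := by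
  ext K
  have h1 : ∑ i, M.len K i * M.flux u K i = ∑ i, M.len K i * M.flux (constP1dv g) K i := by
    refine Finset.sum_congr rfl fun i _ => ?_
    rw [flux, flux, h K _ (M.edgeSet_subset_cell K i (M.mid_mem_edgeSet K i))]
    rfl
  rw [M.sum_len_flux, M.sum_len_flux] at h1
  have h2 : M.divRT (constP1dv g) K = 0 := by simp [divRT, constP1dv]
  rw [h2, mul_zero] at h1
  have := abs_pos.2 (triDet_ne_zero (M.tri K))
  exact (mul_eq_zero.1 h1).resolve_left (by positivity)

/-- Piecewise constant fields in `RT₀` are orthogonal to the discrete gradients. -/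
lemma IsRT0.sum_area_mul_inner_gradh {g : M.P0v} (hg : M.IsRT0 (constP1dv g)) {p : M.P1d}
    (hp : M.IsP1nc p) : ∑ K, M.area K * inner ℝ (M.gradh p K) (g K) = 0 := by
  have hmid : ∀ K i L j, K ≠ L → M.edge K i = M.edge L j →
      p K (M.mid K i) = p L (M.mid L j) := by
    intro K i L j hKL he
    rcases lt_or_gt_of_ne hKL with h | h
    · have := hp ((K, i), (L, j)) (M.mem_intEdges.2 ⟨h, he⟩)
      rwa [← M.mid_congr he]
    · have := hp ((L, j), (K, i)) (M.mem_intEdges.2 ⟨h, he.symm⟩)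
      rw [M.mid_congr he]
      exact this.symm
  have hflux : ∀ K i, M.flux (constP1dv g) K i = inner ℝ (g K) (M.normal K i) := fun _ _ => rfl
  have h := M.sum_sum_eq_zero
    (fun K i => M.len K i * inner ℝ (g K) (M.normal K i) * p K (M.mid K i))
    (fun K i he => by simp only [← hflux, hg.flux_eq_zero he, mul_zero, zero_mul])
    (fun K i L j hKL he => by
      simp only [← hflux, hg.flux_eq_neg hKL he, M.len_congr he, hmid K i L j hKL he]
      ring)
  simp only [M.sum_len_inner_normal_mul] at h
  have : ∀ K, M.area K * inner ℝ (M.gradh p K) (g K) =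
      2 * refArea * (|triDet (M.tri K)| / 2 * inner ℝ (M.gradh p K) (g K)) := fun K => by
    rw [M.area_eq]; ring
  simp only [this, ← Finset.mul_sum, h, mul_zero]

/-- The energy estimate for the pressure. -/
lemma sum_area_mul_norm_gradh_sq_le {f : M.P0v} {κ : M.P0} {p : M.P1d} {κ₀ : ℝ} (hκ₀ : 0 < κ₀)
    (hκ : ∀ K, κ₀ ≤ κ K) (hp : M.IsP1nc p)
    (hg : M.IsRT0 (constP1dv fun K => f K - κ K • M.gradh p K)) :
    ∑ K, M.area K * ‖M.gradh p K‖ ^ 2 ≤ (∑ K, M.area K * ‖f K‖ ^ 2) / κ₀ ^ 2 := by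
  have h := hg.sum_area_mul_inner_gradh hp
  rw [le_div_iff₀ (by positivity), Finset.sum_mul]
  -- Young's inequality on each triangle; the right side vanishes by orthogonality
  have h2 : ∑ K, (M.area K * ‖M.gradh p K‖ ^ 2 * κ₀ ^ 2 - M.area K * ‖f K‖ ^ 2) ≤
      ∑ K, -2 * κ₀ * (M.area K * inner ℝ (M.gradh p K) (f K - κ K • M.gradh p K)) := by
    refine Finset.sum_le_sum fun K _ => ?_
    rw [inner_sub_right, inner_smul_right, real_inner_self_eq_norm_sq]
    have hy : 2 * κ₀ * inner ℝ (M.gradh p K) (f K) ≤ κ₀ ^ 2 * ‖M.gradh p K‖ ^ 2 + ‖f K‖ ^ 2 := by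
      have := real_inner_le_norm (M.gradh p K) (f K)
      nlinarith [sq_nonneg (κ₀ * ‖M.gradh p K‖ - ‖f K‖)]
    have hz : κ₀ ^ 2 * ‖M.gradh p K‖ ^ 2 ≤ κ₀ * (κ K * ‖M.gradh p K‖ ^ 2) := by
      rw [sq κ₀, mul_assoc]
      exact mul_le_mul_of_nonneg_left
        (mul_le_mul_of_nonneg_right (hκ K) (by positivity)) hκ₀.le
    have := mul_le_mul_of_nonneg_left (add_le_add hy (mul_le_mul_of_nonneg_left hz zero_le_two))
      (M.area_pos K).le
    linarith
  rw [← Finset.mul_sum, h, mul_zero, Finset.sum_sub_distrib] at h2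
  linarith

end Mesh

/-! ### The solutions of the scheme -/

/-- Summation of one-step estimates. -/
lemma add_sum_Icc_le {E X : ℕ → ℝ} {B : ℝ} {N : ℕ}
    (h : ∀ n < N, E (n + 1) + X (n + 1) ≤ E n + B) {m : ℕ} (hm : m ≤ N) :
    E m + ∑ n ∈ Finset.Icc 1 m, X n ≤ E 0 + m * B := by
  induction m with
  | zero => simp
  | succ m ih =>
    have h1 := ih (by omega)
    have h2 := h m (by omega)
    rw [Finset.sum_Icc_succ_top (by omega)]
    push_cast
    linarith

namespace IsSolution

variable {D : Data} {M : Mesh D.Ω} {N : ℕ} {c θ : ℕ → M.P0} {p : ℕ → M.P1d} {u : ℕ → M.P1dv}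

/-- The filtration flux belongs to `RT₀`, so that projecting it does not change it. -/
lemma isRT0_flux (h : IsSolution D M N c θ p u) (hs : M.projP0 D.s = 0) {n : ℕ} (hn : n < N) :
    M.IsRT0 (Mesh.constP1dv fun K => M.projP0 (D.f ((n + 1 : ℕ) * (D.T / N))) K -
      D.κ (c (n + 1) K) (θ (n + 1) K) • M.gradh (p (n + 1)) K) := by
  obtain ⟨a, b, r, ha, hb, hr, hab⟩ := h.eq_p n hn
  rw [hs] at hr
  refine Mesh.isRT0_constP1dv_of_divh_eq ha hb fun K i => ?_
  have := hr.eq_zero (M.edgeSet_subset_cell K i (M.mid_mem_edgeSet K i))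
  rw [hab, Pi.sub_apply, AffineMap.coe_sub, Pi.sub_apply, this, sub_zero]

lemma isRT0 (h : IsSolution D M N c θ p u) {n : ℕ} (hn : n ≤ N) : M.IsRT0 (u n) := by
  cases n with
  | zero => exact h.u_init_mem
  | succ n => exact (h.eq_u n hn).1

lemma divRT_eq_zero (h : IsSolution D M N c θ p u) (hs : M.projP0 D.s = 0) {n : ℕ}
    (hn : n ≤ N) : M.divRT (u n) = 0 := by
  cases n with
  | zero => rw [h.u_init_div, hs]
  | succ n =>
    exact Mesh.divRT_eq_zero_of_eq_const
      fun K x hx => (h.eq_u n hn).eq_of_isRT0 (h.isRT0_flux hs hn) hx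

lemma projP0_s (h : IsSolution D M N c θ p u) (hD : D.Admissible) : M.projP0 D.s = 0 := by
  ext K
  refine Mesh.projP0_eq_zero ?_
  filter_upwards [hD.sources_ae_eq_zero h.u_init_mem h.u_init_div K] with x hx using hx.1

lemma projP0_sθ (h : IsSolution D M N c θ p u) (hD : D.Admissible) : M.projP0 D.sθ = 0 := by
  ext K
  refine Mesh.projP0_eq_zero ?_
  filter_upwards [hD.sources_ae_eq_zero h.u_init_mem h.u_init_div K] with x hx using hx.2

lemma projP0_sc_mem (h : IsSolution D M N c θ p u) (hD : D.Admissible) (K : Fin M.n) :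
    M.projP0 D.sc K ∈ Icc 0 D.lam := by
  have hle := Mesh.restrict_cell_le (M := M) hD.domain.regular K
  have hint := (hD.sc_mem.mono_measure hle).integrable (by norm_num)
  constructor
  · refine M.le_projP0 hint ?_
    filter_upwards [ae_mono hle hD.sc_bounds] with x hx using hx.1
  · refine M.projP0_le hint ?_
    filter_upwards [ae_mono hle hD.sc_bounds,
      hD.sources_ae_eq_zero h.u_init_mem h.u_init_div K] with x hx hx'
    linarith [hx.2, hx'.1]

lemma step_c (h : IsSolution D M N c θ p u) (hD : D.Admissible) {n : ℕ} (hn : n < N)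
    (K : Fin M.n) :
    (c (n + 1) K - c n K) / (D.T / N) - D.Dc * M.laph (c (n + 1)) K =
      (M.projP0 D.sc K - D.lam * c (n + 1) K) - M.convh (u n) (c (n + 1)) K := by
  have := h.eq_c n hn K
  rwa [h.projP0_s hD, Pi.zero_apply, zero_add] at this

lemma step_θ (h : IsSolution D M N c θ p u) (hD : D.Admissible) {n : ℕ} (hn : n < N)
    (K : Fin M.n) :
    (θ (n + 1) K - θ n K) / (D.T / N) - D.Dθ * M.laph (θ (n + 1)) K =
      0 - M.convh (u n) (θ (n + 1)) K := by
  have := h.eq_θ n hn K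
  rwa [h.projP0_s hD, h.projP0_sθ hD, Pi.zero_apply, neg_zero, zero_mul, sub_zero] at this

lemma c_mem (h : IsSolution D M N c θ p u) (hD : D.Admissible) {n : ℕ} (hn : n ≤ N)
    (K : Fin M.n) : c n K ∈ Icc (0 : ℝ) 1 := by
  induction n generalizing K with
  | zero =>
    have hle := Mesh.restrict_cell_le (M := M) hD.domain.regular K
    have hint := (hD.c₀_mem.1.mono_measure hle).integrable (by norm_num)
    rw [h.c_init]
    constructor
    · refine M.le_projP0 hint ?_
      filter_upwards [ae_mono hle hD.c₀_bounds] with x hx using hx.1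
    · refine M.projP0_le hint ?_
      filter_upwards [ae_mono hle hD.c₀_bounds] with x hx using hx.2
  | succ n ih =>
    have hN : (0 : ℝ) < N := by exact_mod_cast (by omega : 0 < N)
    have hk : 0 < D.T / N := div_pos hD.T_pos hN
    have hu := h.isRT0 (n := n) (by omega)
    have hdiv := h.divRT_eq_zero (h.projP0_s hD) (n := n) (by omega)
    constructor
    · exact hu.ge_of_implicit_step hdiv hk hD.Dc_pos.le hD.lam_pos.le
        (fun K => (ih (by omega) K).1) (h.step_c hD hn)
        (fun K => by linarith [(h.projP0_sc_mem hD K).1]) K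
    · exact hu.le_of_implicit_step hdiv hk hD.Dc_pos.le hD.lam_pos.le
        (fun K => (ih (by omega) K).2) (h.step_c hD hn)
        (fun K => by linarith [(h.projP0_sc_mem hD K).2]) K

lemma θ_mem (h : IsSolution D M N c θ p u) (hD : D.Admissible) {n : ℕ} (hn : n ≤ N)
    (K : Fin M.n) : θ n K ∈ Icc D.θlo D.θhi := by
  induction n generalizing K with
  | zero =>
    have hle := Mesh.restrict_cell_le (M := M) hD.domain.regular K
    have hint := (hD.θ₀_mem.1.mono_measure hle).integrable (by norm_num)
    rw [h.θ_init]
    constructor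
    · refine M.le_projP0 hint ?_
      filter_upwards [ae_mono hle hD.θ₀_bounds] with x hx using hx.1
    · refine M.projP0_le hint ?_
      filter_upwards [ae_mono hle hD.θ₀_bounds] with x hx using hx.2
  | succ n ih =>
    have hN : (0 : ℝ) < N := by exact_mod_cast (by omega : 0 < N)
    have hk : 0 < D.T / N := div_pos hD.T_pos hN
    have hu := h.isRT0 (n := n) (by omega)
    have hdiv := h.divRT_eq_zero (h.projP0_s hD) (n := n) (by omega)
    constructor
    · exact hu.ge_of_implicit_step hdiv (r := 0) hk hD.Dθ_pos.le le_rfl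
        (fun K => (ih (by omega) K).1) (h.step_θ hD hn) (fun K => by simp) K
    · exact hu.le_of_implicit_step hdiv (r := 0) hk hD.Dθ_pos.le le_rfl
        (fun K => (ih (by omega) K).2) (h.step_θ hD hn) (fun K => by simp) K

lemma sum_normh_c_le (h : IsSolution D M N c θ p u) (hD : D.Admissible) {m : ℕ} (hm : m ≤ N)
    (hm1 : 1 ≤ m) : D.T / N * ∑ n ∈ Finset.Icc 1 m, M.normh (c n) ^ 2 ≤
      (volume.real D.Ω / 2 + D.T * (D.lam * volume.real D.Ω)) / D.Dc := by
  have hN : (0 : ℝ) < N := by exact_mod_cast (by omega : 0 < N)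
  have hk : 0 < D.T / N := div_pos hD.T_pos hN
  have hA := M.sum_area_le hD.domain.regular hD.domain.isBounded
  have key := add_sum_Icc_le (N := N) (E := fun n => (∑ K, M.area K * c n K ^ 2) / 2)
    (X := fun n => D.Dc * (D.T / N * M.normh (c n) ^ 2))
    (B := D.T / N * (D.lam * volume.real D.Ω)) (fun n hn => by
      refine ((h.isRT0 hn.le).energy_step (h.divRT_eq_zero (h.projP0_s hD) hn.le) hk
        (h.step_c hD hn)).trans ?_
      gcongr
      calc ∑ K, M.area K * ((M.projP0 D.sc K - D.lam * c (n + 1) K) * c (n + 1) K)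
          ≤ ∑ K, D.lam * M.area K := by
            refine Finset.sum_le_sum fun K _ => ?_
            rw [mul_comm D.lam (M.area K)]
            refine mul_le_mul_of_nonneg_left ?_ (M.area_pos K).le
            have h1 := h.c_mem hD (n := n + 1) hn K
            have h2 := h.projP0_sc_mem hD K
            have h3 := hD.lam_pos
            nlinarith [mul_nonneg h3.le (sq_nonneg (c (n + 1) K)),
              mul_le_mul h2.2 h1.2 h1.1 h3.le]
        _ ≤ _ := by
            rw [← Finset.mul_sum]
            exact mul_le_mul_of_nonneg_left hA hD.lam_pos.le) hm
  have h0 : ∑ K, M.area K * c 0 K ^ 2 ≤ volume.real D.Ω := by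
    refine (Finset.sum_le_sum fun K _ => ?_).trans hA
    have h1 := h.c_mem hD (n := 0) (by omega) K
    exact mul_le_of_le_one_right (M.area_pos K).le (pow_le_one₀ h1.1 h1.2)
  have hE : 0 ≤ ∑ K, M.area K * c m K ^ 2 :=
    Finset.sum_nonneg fun K _ => mul_nonneg (M.area_pos K).le (sq_nonneg _)
  have hmk : m * (D.T / N * (D.lam * volume.real D.Ω)) ≤ D.T * (D.lam * volume.real D.Ω) := by
    rw [← mul_assoc]
    refine mul_le_mul_of_nonneg_right ?_ (mul_nonneg hD.lam_pos.le measureReal_nonneg)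
    rw [mul_div_assoc', div_le_iff₀ hN, mul_comm]
    exact mul_le_mul_of_nonneg_left (by exact_mod_cast hm) hD.T_pos.le
  rw [le_div_iff₀ hD.Dc_pos]
  simp only [← Finset.mul_sum] at key
  linarith

lemma sum_normh_θ_le (h : IsSolution D M N c θ p u) (hD : D.Admissible) {m : ℕ} (hm : m ≤ N)
    (hm1 : 1 ≤ m) : D.T / N * ∑ n ∈ Finset.Icc 1 m, M.normh (θ n) ^ 2 ≤
      (D.θhi ^ 2 * volume.real D.Ω / 2) / D.Dθ := by
  have hN : (0 : ℝ) < N := by exact_mod_cast (by omega : 0 < N)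
  have hk : 0 < D.T / N := div_pos hD.T_pos hN
  have hA := M.sum_area_le hD.domain.regular hD.domain.isBounded
  have key := add_sum_Icc_le (N := N) (E := fun n => (∑ K, M.area K * θ n K ^ 2) / 2)
    (X := fun n => D.Dθ * (D.T / N * M.normh (θ n) ^ 2)) (B := 0) (fun n hn => by
      have := (h.isRT0 hn.le).energy_step (r := 0) (h.divRT_eq_zero (h.projP0_s hD) hn.le) hk
        (h.step_θ hD hn)
      simpa using this) hm
  have h0 : ∑ K, M.area K * θ 0 K ^ 2 ≤ D.θhi ^ 2 * volume.real D.Ω := by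
    refine le_trans ?_ (mul_le_mul_of_nonneg_left hA (sq_nonneg _))
    rw [Finset.mul_sum]
    refine Finset.sum_le_sum fun K _ => ?_
    have h1 := h.θ_mem hD (n := 0) (by omega) K
    rw [mul_comm]
    exact mul_le_mul_of_nonneg_right
      (pow_le_pow_left₀ (hD.θlo_pos.le.trans h1.1) h1.2 2) (M.area_pos K).le
  have hE : 0 ≤ ∑ K, M.area K * θ m K ^ 2 :=
    Finset.sum_nonneg fun K _ => mul_nonneg (M.area_pos K).le (sq_nonneg _)
  rw [le_div_iff₀ hD.Dθ_pos]
  simp only [← Finset.mul_sum] at key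
  linarith

/-- The bounds on `c` and `θ` enter through the mobility, which is evaluated at `(c, θ)`. -/
lemma velocity_le (h : IsSolution D M N c θ p u) (hD : D.Admissible) {F κ₁ : ℝ} (hF : 0 ≤ F)
    (hf : ∀ t ∈ Icc 0 D.T, (eLpNorm (D.f t) 2 (volume.restrict D.Ω)).toReal ≤ F)
    (hκ : ∀ a ∈ Icc (0 : ℝ) 1, ∀ b ∈ Icc D.θlo D.θhi, D.κ a b ≤ κ₁)
    {m : ℕ} (hm : m ≤ N) (hm1 : 1 ≤ m) :
    M.l2norm (M.pa (u m)) + M.l2norm (M.pc (M.gradh (p m))) ≤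
      Real.sqrt (2 * F ^ 2 + 2 * κ₁ ^ 2 * (F ^ 2 / D.κinf ^ 2)) + F / D.κinf := by
  obtain ⟨n, rfl⟩ : ∃ n, m = n + 1 := ⟨m - 1, by omega⟩
  have hN : (0 : ℝ) < N := by exact_mod_cast (by omega : 0 < N)
  have hT := hD.T_pos
  have hκ₀ := hD.κinf_pos
  have hs := h.projP0_s hD
  set t : ℝ := (n + 1 : ℕ) * (D.T / N) with ht
  have htmem : t ∈ Icc 0 D.T := by
    refine ⟨by positivity, ?_⟩
    rw [ht, mul_div_assoc', div_le_iff₀ hN, mul_comm]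
    exact mul_le_mul_of_nonneg_left (by exact_mod_cast hm) hT.le
  have hfh : ∑ K, M.area K * ‖M.projP0 (D.f t) K‖ ^ 2 ≤ F ^ 2 :=
    (M.sum_area_mul_norm_projP0_sq_le hD.domain.regular (hD.f_mem t htmem)).trans
      (pow_le_pow_left₀ ENNReal.toReal_nonneg (hf t htmem) 2)
  have hge : ∀ K, D.κinf ≤ D.κ (c (n + 1) K) (θ (n + 1) K) := fun K =>
    hD.κ_ge _ (h.c_mem hD hm K) _ (hD.θlo_pos.trans_le (h.θ_mem hD hm K).1)
  have hle : ∀ K, D.κ (c (n + 1) K) (θ (n + 1) K) ≤ κ₁ := fun K =>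
    hκ _ (h.c_mem hD hm K) _ (h.θ_mem hD hm K)
  have hgrad : ∑ K, M.area K * ‖M.gradh (p (n + 1)) K‖ ^ 2 ≤ F ^ 2 / D.κinf ^ 2 :=
    (Mesh.sum_area_mul_norm_gradh_sq_le hκ₀ hge (h.p_mem n hm).1 (h.isRT0_flux hs hm)).trans
      (by gcongr)
  refine add_le_add ?_ ?_
  · have hu := Mesh.l2norm_congr M (v := M.pa (u (n + 1))) (w := M.pc _)
      fun K x hx => (h.eq_u n hm).eq_of_isRT0 (h.isRT0_flux hs hm) hx
    rw [hu]
    refine Real.le_sqrt_of_sq_le ?_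
    rw [Mesh.l2norm_pc_sq]
    calc ∑ K, M.area K * ‖M.projP0 (D.f t) K -
            D.κ (c (n + 1) K) (θ (n + 1) K) • M.gradh (p (n + 1)) K‖ ^ 2
        ≤ ∑ K, (2 * (M.area K * ‖M.projP0 (D.f t) K‖ ^ 2) +
            2 * κ₁ ^ 2 * (M.area K * ‖M.gradh (p (n + 1)) K‖ ^ 2)) := by
          refine Finset.sum_le_sum fun K _ => ?_
          set x := M.projP0 (D.f t) K
          set y := M.gradh (p (n + 1)) K
          have h1 : ‖x - D.κ (c (n + 1) K) (θ (n + 1) K) • y‖ ≤ ‖x‖ + κ₁ * ‖y‖ := by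
            refine (norm_sub_le _ _).trans ?_
            rw [norm_smul, Real.norm_of_nonneg (hκ₀.le.trans (hge K))]
            gcongr
            exact hle K
          have h2 : ‖x - D.κ (c (n + 1) K) (θ (n + 1) K) • y‖ ^ 2 ≤
              2 * ‖x‖ ^ 2 + 2 * κ₁ ^ 2 * ‖y‖ ^ 2 :=
            (pow_le_pow_left₀ (norm_nonneg _) h1 2).trans
              (by nlinarith [sq_nonneg (‖x‖ - κ₁ * ‖y‖)])
          have := mul_le_mul_of_nonneg_left h2 (M.area_pos K).le
          linarith
      _ ≤ _ := by
          rw [Finset.sum_add_distrib, ← Finset.mul_sum, ← Finset.mul_sum]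
          gcongr
  · refine abs_le_of_sq_le_sq' ?_ (by positivity) |>.2
    rw [Mesh.l2norm_pc_sq, div_pow]
    exact hgrad

end IsSolution
end DarcyScheme
end

theorem mainTheorem5 (D : DarcyScheme.Data) (hD : D.Admissible) (ρ : ℝ) (hρ : 0 < ρ) :
    ∃ C : ℝ, ∀ (M : DarcyScheme.Mesh D.Ω), M.Regular ρ → ∀ N : ℕ, 1 ≤ N →
      ∀ (c θ : ℕ → M.P0) (p : ℕ → M.P1d) (u : ℕ → M.P1dv),
        DarcyScheme.IsSolution D M N c θ p u →
        ∀ m : ℕ, 1 ≤ m → m ≤ N →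
          D.T / N * ∑ n ∈ Finset.Icc 1 m, M.normh (c n) ^ 2 +
              D.T / N * ∑ n ∈ Finset.Icc 1 m, M.normh (θ n) ^ 2 ≤ C ∧
          M.l2norm (M.pa (u m)) + M.l2norm (M.pc (M.gradh (p m))) ≤ C := by
  obtain ⟨F, hF⟩ := (isCompact_Icc.image_of_continuousOn hD.f_cont).bddAbove
  have hsub : Icc (0 : ℝ) 1 ×ˢ Icc D.θlo D.θhi ⊆ Icc (0 : ℝ) 1 ×ˢ Ioi 0 :=
    prod_mono_right fun b hb => hD.θlo_pos.trans_le hb.1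
  obtain ⟨κ₁, hκ₁⟩ := ((isCompact_Icc.prod isCompact_Icc).image_of_continuousOn
    (hD.κ_cont.mono hsub)).bddAbove
  have hf : ∀ t ∈ Icc 0 D.T, (eLpNorm (D.f t) 2 (volume.restrict D.Ω)).toReal ≤ F :=
    fun t ht => hF (mem_image_of_mem _ ht)
  have hF0 : 0 ≤ F := ENNReal.toReal_nonneg.trans (hf 0 ⟨le_rfl, hD.T_pos.le⟩)
  have hκ : ∀ a ∈ Icc (0 : ℝ) 1, ∀ b ∈ Icc D.θlo D.θhi, D.κ a b ≤ κ₁ :=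
    fun a ha b hb => hκ₁ (mem_image_of_mem (Function.uncurry D.κ) (x := (a, b)) ⟨ha, hb⟩)
  refine ⟨max ((volume.real D.Ω / 2 + D.T * (D.lam * volume.real D.Ω)) / D.Dc +
      (D.θhi ^ 2 * volume.real D.Ω / 2) / D.Dθ)
    (Real.sqrt (2 * F ^ 2 + 2 * κ₁ ^ 2 * (F ^ 2 / D.κinf ^ 2)) + F / D.κinf),
    fun M _ N _ c θ p u h m hm1 hm => ⟨?_, ?_⟩⟩
  · exact (add_le_add (h.sum_normh_c_le hD hm hm1) (h.sum_normh_θ_le hD hm hm1)).trans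
      (le_max_left _ _)
  · exact (h.velocity_le hD hF0 hf hκ hm hm1).trans (le_max_right _ _)
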